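/- Consider $N$ identical linear subsystems with real matrices $A\in\mathbb R^{n\times n}$, $B\in\mathbb R^{n\times m}$, $C\in\mathbb R^{m\times n}$, coupled as $$\dot x_i = A x_i + B\Big(\alpha\sum_{j\ne i} g_{ij}(y_j-y_i)+\gamma_i w_i\Big),\qquad y_i = C x_i,\qquad i=1,\dots,N,$$ with weights $g_{ij}\ge 0$ ($i\neq j$), coupling constant $\alpha\in\mathbb R$, and a disturbance at a single source $s$ ($\gamma_s=1$, $\gamma_i=0$ for $i\ne s$). The digraph $\Gamma$ on $\{1,\dots,N\}$ has an edge from $j$ to $i$ if and only if $g_{ij}>0$. A nonempty vertex set $V_C$ is a separating cutset for $s$, with far side $V_B$, if the remaining vertices are the disjoint union of sets $V_1$ (possibly empty) and $V_B$ such that there is no edge from $V_1$ to $V_B$ and $s\in V_1\cup V_C$. For the response to $w_s$ with zero initial state put $E_i(T)=\int_0^T y_i(t)^{\mathsf T}y_i(t)\,dt$. The network is called propagation stable if 1. for the undisturbed network the synchronization manifold $\{x_1=\dots=x_N\}$ is asymptotically stable in the sense of Lyapunov, and 2. for every source $s$, every disturbance $w_s$ satisfying the Dirichlet conditions (on every bounded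 time interval each component is absolutely integrable and bounded, with finitely many discontinuities and piecewise monotone with finitely many pieces), every separating cutset $V_C$ for $s$ with far side $V_B$, every $T>0$ and every $b\in V_B$, one has $E_b(T)\le\max_{c\in V_C}E_c(T)$. The poles of the subsystem are the eigenvalues of $A$. Assume that the subsystem is single-input single-output ($m=1$). Then: (i) If the subsystem has a pole in the open right half-plane, then for every $N\ge 2$, all weights $g_{ij}\ge 0$ and every $\alpha\in\mathbb R$, the network is not propagation stable. (ii) If all poles of the subsystem lie in the open left half-plane, then for every $N$ and all weights $g_{ij}\ge0$ there is $\bar\alpha>0$ such that the network is propagation stable for all $\alpha$ with $0\le\alpha\le\bar\alpha$. -/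

import Mathlib

open Set Filter Topology MeasureTheory
open scoped Matrix

/-- State, input and output matrices `(A, B, C)` of one subsystem
`ẋ = A x + B u`, `y = C x`, with `n` states and `m` inputs and outputs.
The subsystem is single-input single-output when `m = 1`. -/
structure Subsystem (n m : ℕ) where
  A : Matrix (Fin n) (Fin n) ℝ
  B : Matrix (Fin n) (Fin m) ℝ
  C : Matrix (Fin m) (Fin n) ℝ

namespace Subsystem

variable {n m N : ℕ}

/-- The poles of the state-space model `(A, B, C)`: the complex eigenvalues of `A`. -/
def IsPole (S : Subsystem n m) (μ : ℂ) : Prop :=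
  Module.End.HasEigenvalue (Matrix.toLin' (S.A.map (algebraMap ℝ ℂ))) μ

/-- Some pole lies in the open right half-plane. -/
def HasOpenRHPPole (S : Subsystem n m) : Prop :=
  ∃ μ : ℂ, S.IsPole μ ∧ 0 < μ.re

/-- All poles lie in the open left half-plane. -/
def StrictlyStable (S : Subsystem n m) : Prop :=
  ∀ μ : ℂ, S.IsPole μ → μ.re < 0

/-- Right-hand side of the network synchronization model: component `i` is
`A xᵢ + B (α ∑_{j ≠ i} gᵢⱼ (yⱼ - yᵢ) + vᵢ)` with `yᵢ = C xᵢ`, where `vᵢ` is the external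
input at subsystem `i`. -/
def networkField (S : Subsystem n m) (α : ℝ) (g : Fin N → Fin N → ℝ)
    (v : Fin N → Fin m → ℝ) (x : Fin N → Fin n → ℝ) : Fin N → Fin n → ℝ :=
  fun i => S.A *ᵥ x i +
    S.B *ᵥ (α • (∑ j ∈ Finset.univ.erase i, g i j • (S.C *ᵥ x j - S.C *ᵥ x i)) + v i)

/-- `x` solves the network synchronization model on `[0, ∞)` with external input `v`, in the
(Carathéodory) integral form, since the input may have jumps. -/
def IsTrajectory (S : Subsystem n m) (α : ℝ) (g : Fin N → Fin N → ℝ)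
    (v : ℝ → Fin N → Fin m → ℝ) (x : ℝ → Fin N → Fin n → ℝ) : Prop :=
  ContinuousOn x (Ici 0) ∧
    ∀ t : ℝ, 0 ≤ t → x t = x 0 + ∫ τ in (0 : ℝ)..t, S.networkField α g (v τ) (x τ)

/-- The zero-state response to a disturbance `w` applied at the single source vertex `s`. -/
def IsDisturbanceResponse (S : Subsystem n m) (α : ℝ) (g : Fin N → Fin N → ℝ)
    (s : Fin N) (w : ℝ → Fin m → ℝ) (x : ℝ → Fin N → Fin n → ℝ) : Prop :=
  S.IsTrajectory α g (fun τ => Pi.single s (w τ)) x ∧ x 0 = 0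

/-- The energy `Eᵢ(T) = ∫₀ᵀ yᵢᵀ yᵢ dt` of the output at vertex `i` over `[0, T]`. -/
noncomputable def energy (S : Subsystem n m) (x : ℝ → Fin N → Fin n → ℝ) (T : ℝ)
    (i : Fin N) : ℝ :=
  ∫ t in (0 : ℝ)..T, (S.C *ᵥ x t i) ⬝ᵥ (S.C *ᵥ x t i)

end Subsystem

/-- The synchronization manifold: all subsystem states are identical. -/
def syncManifold (N n : ℕ) : Set (Fin N → Fin n → ℝ) :=
  {x | ∀ i j, x i = x j}

/-- The synchronization manifold is asymptotically stable in the sense of Lyapunov for the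
undisturbed network: it is a Lyapunov stable set, and it attracts all nearby trajectories. -/
def Subsystem.SyncManifoldAsymptoticallyStable {n m N : ℕ} (S : Subsystem n m) (α : ℝ)
    (g : Fin N → Fin N → ℝ) : Prop :=
  (∀ ε : ℝ, 0 < ε → ∃ δ : ℝ, 0 < δ ∧ ∀ x : ℝ → Fin N → Fin n → ℝ,
    S.IsTrajectory α g (fun _ => 0) x →
    Metric.infDist (x 0) (syncManifold N n) < δ →
    ∀ t : ℝ, 0 ≤ t → Metric.infDist (x t) (syncManifold N n) < ε) ∧
  (∃ δ : ℝ, 0 < δ ∧ ∀ x : ℝ → Fin N → Fin n → ℝ,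
    S.IsTrajectory α g (fun _ => 0) x →
    Metric.infDist (x 0) (syncManifold N n) < δ →
    Tendsto (fun t => Metric.infDist (x t) (syncManifold N n)) atTop (𝓝 0))

/-- The Dirichlet conditions for a scalar signal on `[0, ∞)`: on each interval `[0, T]` it is
absolutely integrable, bounded, and has finitely many discontinuities and finitely many maxima
and minima, i.e. it is monotone on each of the finitely many pieces cut out by a finite set. -/
structure SatisfiesDirichlet (u : ℝ → ℝ) : Prop where
  integrable : ∀ T : ℝ, 0 < T → IntegrableOn u (Icc 0 T)
  bounded : ∀ T : ℝ, 0 < T → ∃ M : ℝ, ∀ t ∈ Icc 0 T, |u t| ≤ M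
  finite_discontinuities : ∀ T : ℝ, 0 < T →
    {t ∈ Icc 0 T | ¬ ContinuousWithinAt u (Icc 0 T) t}.Finite
  piecewise_monotone : ∀ T : ℝ, 0 < T → ∃ P : Finset ℝ, ∀ a b : ℝ, 0 ≤ a → b ≤ T →
    (∀ t ∈ Ioo a b, t ∉ P) → MonotoneOn u (Ioo a b) ∨ AntitoneOn u (Ioo a b)

/-- `VC` is a separating cutset for the source `s` in the digraph with an edge from `j` to `i`
whenever `g i j > 0`, witnessed by the partition of the remaining vertices into `V1` and `VB`.
The set `V1` may be empty, in particular `{s}` is a separating cutset. -/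
structure IsSeparatingCutset {N : ℕ} (g : Fin N → Fin N → ℝ) (s : Fin N)
    (VC V1 VB : Finset (Fin N)) : Prop where
  nonempty : VC.Nonempty
  union_eq : V1 ∪ VB = Finset.univ \ VC
  disjoint : Disjoint V1 VB
  no_edge : ∀ a ∈ V1, ∀ b ∈ VB, ¬ 0 < g b a
  source_mem : s ∈ V1 ∪ VC

/-- Propagation stability of the network synchronization model with subsystem `S`,
coupling strength `α` and coupling weights `g`. -/
def PropagationStable {n m N : ℕ} (S : Subsystem n m) (α : ℝ) (g : Fin N → Fin N → ℝ) : Prop :=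
  S.SyncManifoldAsymptoticallyStable α g ∧
  ∀ (s : Fin N) (w : ℝ → Fin m → ℝ), (∀ k, SatisfiesDirichlet (fun t => w t k)) →
    ∀ x : ℝ → Fin N → Fin n → ℝ, S.IsDisturbanceResponse α g s w x →
    ∀ (VC V1 VB : Finset (Fin N)) (h : IsSeparatingCutset g s VC V1 VB) (T : ℝ), 0 < T →
    ∀ b ∈ VB, S.energy x T b ≤ VC.sup' h.nonempty (fun v => S.energy x T v)

/-! ### Quadratic Lyapunov functions for Hurwitz matrices. -/

section Lyapunov

/-! Part (ii) is a small-gain argument. A Hurwitz `A` has a quadratic Lyapunov function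
(`exists_lyapunov_matrix`), which gives a finite L² gain κ from input to output (`exists_gain`) and
exponential decay that survives small couplings (`exists_decay`). Applied to the differences `x i -
x i₀`, the decay makes the synchronization manifold attractive. For the energies, let `b` have the
largest energy in `VB` and suppose that it exceeds every energy in `VC`. No edge enters `b` from
`V1`, so its coupling input is driven only by vertices of energy at most that of `b`. The gain then
bounds E_b by a constant times α² E_b, which is impossible for small α.

Part (i) is by contradiction. Let μ be a pole with positive real part. Stability of the manifold
forces every left μ-eigenvector of `A` to be nonzero on the input vector; tensored with a left null
vector of the Laplacian it gives a left eigenvector of the whole network, and hence a right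
eigenvector X in the reachable space of some vertex s (`exists_reachable_eigenvector`). Stability
also makes X synchronous with nonzero output (`eigenvector_sync`, `output_ne_zero`), and some vertex
b must answer a unit step at s differently from s itself (`exists_output_unitStep_ne`).

Now steer the network into the mode X, let it grow by a factor ρ^k, and apply a unit step at s
(`exists_response_energy_eq`). The mode contributes the same amount to E_b and E_s, so the terms of
order ρ^(2k) cancel in E_b - E_s. The cross term between the mode and the step responses has order
ρ^k, and the phase of X can be chosen to make it positive. For large k this gives E_b > E_s, which
contradicts condition 2 for the cutset {s}. -/

theorem tendsto_pow_zero_of_spectralRadius_lt_one {R : Type*} [NormedRing R] [NormedAlgebra ℂ R]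
    [CompleteSpace R] (a : R) (h : spectralRadius ℂ a < 1) :
    Tendsto (fun k : ℕ => a ^ k) atTop (𝓝 0) := by
  obtain ⟨r, hr, hr1⟩ := ENNReal.lt_iff_exists_nnreal_btwn.1 h
  have hr1 : r < 1 := by exact_mod_cast hr1
  have h1 := (spectrum.pow_nnnorm_pow_one_div_tendsto_nhds_spectralRadius a).eventually_lt_const hr
  rw [tendsto_zero_iff_norm_tendsto_zero]
  refine squeeze_zero' (Eventually.of_forall fun k => norm_nonneg _) ?_
    (tendsto_pow_atTop_nhds_zero_of_lt_one r.coe_nonneg (by exact_mod_cast hr1))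
  filter_upwards [h1, eventually_gt_atTop 0] with k hk hk0
  have hk' : ((k : ℝ)) ≠ 0 := by exact_mod_cast hk0.ne'
  have h2 := ENNReal.rpow_le_rpow hk.le (Nat.cast_nonneg k : (0 : ℝ) ≤ k)
  rw [← ENNReal.rpow_mul, one_div, inv_mul_cancel₀ hk', ENNReal.rpow_one, ENNReal.rpow_natCast] at h2
  have h3 : ‖a ^ k‖₊ ≤ r ^ k := by exact_mod_cast h2
  exact_mod_cast h3

variable {n : ℕ}

theorem dotProduct_sq_le (x y : Fin n → ℝ) : (x ⬝ᵥ y) ^ 2 ≤ (x ⬝ᵥ x) * (y ⬝ᵥ y) := by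
  have := Finset.sum_mul_sq_le_sq_mul_sq Finset.univ x y
  simpa [dotProduct, pow_two] using this

theorem dotProduct_self_nonneg' (x : Fin n → ℝ) : 0 ≤ x ⬝ᵥ x :=
  Finset.sum_nonneg fun i _ => mul_self_nonneg (x i)

theorem mulVec_dotProduct_self_le (M : Matrix (Fin n) (Fin n) ℝ) (x : Fin n → ℝ) :
    (M *ᵥ x) ⬝ᵥ (M *ᵥ x) ≤ (∑ i, ∑ j, M i j ^ 2) * (x ⬝ᵥ x) := by
  rw [Finset.sum_mul]
  refine Finset.sum_le_sum fun i _ => ?_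
  have := dotProduct_sq_le (M i) x
  simpa [Matrix.mulVec, dotProduct, pow_two] using this

theorem dotProduct_gram_mulVec (M : Matrix (Fin n) (Fin n) ℝ) (x y : Fin n → ℝ) :
    x ⬝ᵥ ((Mᵀ * M) *ᵥ y) = (M *ᵥ x) ⬝ᵥ (M *ᵥ y) := by
  rw [← Matrix.mulVec_mulVec, Matrix.dotProduct_mulVec, Matrix.vecMul_transpose]

theorem Matrix.det_one_sub_ne_zero_of_no_eigenvalue (A : Matrix (Fin n) (Fin n) ℂ)
    (hA : ∀ μ : ℂ, Module.End.HasEigenvalue (Matrix.toLin' A) μ → μ.re < 0) :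
    (1 - A).det ≠ 0 := by
  intro h
  obtain ⟨v, hv, hv0⟩ := Matrix.exists_mulVec_eq_zero_iff.2 h
  have := hA 1 (Module.End.hasEigenvalue_of_hasEigenvector (x := v)
    ⟨by
      rw [Module.End.mem_eigenspace_iff, Matrix.toLin'_apply]
      rw [Matrix.sub_mulVec, Matrix.one_mulVec, sub_eq_zero] at hv0
      rw [← hv0, one_smul], hv⟩)
  norm_num at this

/-- The Cayley transform of a Hurwitz matrix has eigenvalues in the open unit disc. -/
theorem Matrix.tendsto_cayley_pow (A : Matrix (Fin n) (Fin n) ℂ)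
    (hA : ∀ μ : ℂ, Module.End.HasEigenvalue (Matrix.toLin' A) μ → μ.re < 0) (i j : Fin n) :
    Tendsto (fun k : ℕ => (((1 + A) * (1 - A)⁻¹) ^ k) i j) atTop (𝓝 0) := by
  let _ := Matrix.linftyOpNormedRing (n := Fin n) (α := ℂ)
  let _ := Matrix.linftyOpNormedAlgebra (n := Fin n) (α := ℂ) (R := ℂ)
  have hdet : IsUnit (1 - A).det := (Matrix.det_one_sub_ne_zero_of_no_eigenvalue A hA).isUnit
  set M := (1 + A) * (1 - A)⁻¹ with hM
  have : Nonempty (Fin n) := ⟨i⟩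
  -- An eigenvalue k of the Cayley transform comes from the eigenvalue (k - 1)/(k + 1) of `A`, whose
  -- real part has the sign of |k|² - 1.
  have hsp : spectralRadius ℂ M < 1 := by
    have : spectralRadius ℂ M < (1 : NNReal) := by
      refine spectrum.spectralRadius_lt_of_forall_lt M fun k hk => ?_
      rw [← Matrix.spectrum_toLin', ← Module.End.hasEigenvalue_iff_mem_spectrum] at hk
      obtain ⟨v, hv, hv0⟩ := hk.exists_hasEigenvector
      rw [Module.End.mem_eigenspace_iff, Matrix.toLin'_apply] at hv
      set u := (1 - A)⁻¹ *ᵥ v with hu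
      have hvu : v = (1 - A) *ᵥ u := by
        rw [hu, Matrix.mulVec_mulVec, Matrix.mul_nonsing_inv _ hdet, Matrix.one_mulVec]
      have hu0 : u ≠ 0 := by rintro h; exact hv0 (by rw [hvu, h, Matrix.mulVec_zero])
      have h1 : (1 + A) *ᵥ u = k • ((1 - A) *ᵥ u) := by
        rw [← hvu, ← hv, hM, ← Matrix.mulVec_mulVec]
      have h2 : (1 + k) • (A *ᵥ u) = (k - 1) • u := by
        rw [Matrix.add_mulVec, Matrix.sub_mulVec, Matrix.one_mulVec] at h1
        rw [add_smul, sub_smul, one_smul, one_smul]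
        rw [smul_sub] at h1
        linear_combination h1
      have hk1 : 1 + k ≠ 0 := by
        intro h
        rw [h, zero_smul] at h2
        have : k = -1 := by linear_combination h
        rw [this] at h2
        rcases smul_eq_zero.1 h2.symm with h3 | h3
        · norm_num at h3
        · exact hu0 h3
      have h3 : ((k - 1) / (1 + k)).re < 0 := by
        refine hA _ (Module.End.hasEigenvalue_of_hasEigenvector (x := u) ⟨?_, hu0⟩)
        rw [Module.End.mem_eigenspace_iff, Matrix.toLin'_apply, div_eq_inv_mul, mul_smul, ← h2,
          smul_smul, inv_mul_cancel₀ hk1, one_smul]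
      have h4 : 0 < Complex.normSq (1 + k) := Complex.normSq_pos.2 hk1
      rw [Complex.div_re, ← add_div, div_neg_iff] at h3
      have h5 : ‖k‖ ^ 2 < 1 := by
        rw [← Complex.normSq_eq_norm_sq, Complex.normSq_apply]
        rcases h3 with h3 | h3
        · linarith [h3.2]
        · have := h3.1
          simp at this
          nlinarith
      have h6 : ‖k‖ < 1 := by nlinarith [norm_nonneg k]
      exact_mod_cast h6
    exact_mod_cast this
  have h := tendsto_pow_zero_of_spectralRadius_lt_one M hsp
  have hc : Continuous fun X : Matrix (Fin n) (Fin n) ℂ => X i j := by fun_prop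
  exact (hc.tendsto 0).comp h

/-- A Hurwitz matrix admits a quadratic Lyapunov function. -/
theorem exists_lyapunov_matrix (A : Matrix (Fin n) (Fin n) ℝ)
    (hA : ∀ μ : ℂ, Module.End.HasEigenvalue (Matrix.toLin' (A.map (algebraMap ℝ ℂ))) μ → μ.re < 0) :
    ∃ (P : Matrix (Fin n) (Fin n) ℝ) (c : ℝ), 0 < c ∧ Pᵀ = P ∧ (∀ x, x ⬝ᵥ x ≤ x ⬝ᵥ (P *ᵥ x)) ∧
      ∀ x, x ⬝ᵥ (P *ᵥ (A *ᵥ x)) ≤ -c * (x ⬝ᵥ x) := by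
  set M := (1 + A) * (1 - A)⁻¹ with hM
  have hmap : (1 - A).map (algebraMap ℝ ℂ) = 1 - A.map (algebraMap ℝ ℂ) := by
    ext i j; simp [Matrix.one_apply]; split_ifs <;> simp
  have hmap' : (1 + A).map (algebraMap ℝ ℂ) = 1 + A.map (algebraMap ℝ ℂ) := by
    ext i j; simp [Matrix.one_apply]; split_ifs <;> simp
  have hdetC := Matrix.det_one_sub_ne_zero_of_no_eigenvalue _ hA
  have hdet : IsUnit (1 - A).det := by
    rw [isUnit_iff_ne_zero]
    intro h
    apply hdetC
    rw [← hmap]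
    have := (algebraMap ℝ ℂ).map_det (1 - A)
    rw [h, map_zero] at this
    exact this.symm
  have hinv : ((1 - A)⁻¹).map (algebraMap ℝ ℂ) = (1 - A.map (algebraMap ℝ ℂ))⁻¹ := by
    symm
    apply Matrix.inv_eq_left_inv
    rw [← hmap, ← Matrix.map_mul, Matrix.nonsing_inv_mul _ hdet]
    simp
  have hpow : ∀ k : ℕ, (M ^ k).map (algebraMap ℝ ℂ) =
      ((1 + A.map (algebraMap ℝ ℂ)) * (1 - A.map (algebraMap ℝ ℂ))⁻¹) ^ k := by
    intro k
    rw [← hmap', ← hinv, ← Matrix.map_mul, ← hM]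
    exact map_pow (algebraMap ℝ ℂ).mapMatrix M k
  have hlim : ∀ i j, Tendsto (fun k : ℕ => (M ^ k) i j) atTop (𝓝 0) := by
    intro i j
    have h := (Complex.continuous_re.tendsto 0).comp (Matrix.tendsto_cayley_pow _ hA i j)
    simp only [← hpow] at h
    simpa [Function.comp_def] using h
  have hsum : Tendsto (fun k : ℕ => ∑ i, ∑ j, (M ^ k) i j ^ 2) atTop (𝓝 0) := by
    have : Tendsto (fun k : ℕ => ∑ i, ∑ j, (M ^ k) i j ^ 2) atTop
        (𝓝 (∑ i : Fin n, ∑ j : Fin n, (0 : ℝ) ^ 2)) :=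
      tendsto_finsetSum _ fun i _ => tendsto_finsetSum _ fun j _ => (hlim i j).pow 2
    simpa using this
  -- A finite sum up to this k replaces the series solving the discrete Lyapunov equation. The bound
  -- 1/2 makes the telescoped remainder harmless, and k > 0 keeps the term l = 0, which gives P ≥ 1.
  obtain ⟨k, hk, hk0⟩ := ((hsum.eventually_lt_const (show (0 : ℝ) < 1 / 2 by norm_num)).and
    (eventually_gt_atTop 0)).exists
  set P := ∑ l ∈ Finset.range k, (M ^ l)ᵀ * M ^ l with hP
  have hform : ∀ x y, x ⬝ᵥ (P *ᵥ y) = ∑ l ∈ Finset.range k, (M ^ l *ᵥ x) ⬝ᵥ (M ^ l *ᵥ y) := by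
    intro x y
    rw [hP, Matrix.sum_mulVec, dotProduct_sum]
    exact Finset.sum_congr rfl fun l _ => dotProduct_gram_mulVec _ _ _
  set K := ∑ i, ∑ j, (1 - A)⁻¹ i j ^ 2 with hK
  have hK0 : 0 ≤ K := Finset.sum_nonneg fun i _ => Finset.sum_nonneg fun j _ => sq_nonneg _
  refine ⟨P, 1 / (8 * (K + 1)), by positivity, ?_, fun x => ?_, fun x => ?_⟩
  · rw [hP, Matrix.transpose_sum]
    refine Finset.sum_congr rfl fun l _ => ?_
    rw [Matrix.transpose_mul, Matrix.transpose_transpose]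
  · rw [hform]
    have := Finset.single_le_sum (f := fun l => (M ^ l *ᵥ x) ⬝ᵥ (M ^ l *ᵥ x))
      (fun l _ => dotProduct_self_nonneg' _) (Finset.mem_range.2 hk0)
    simpa using this
  · set y := (1 - A) *ᵥ x with hy
    have hMy : M *ᵥ y = (1 + A) *ᵥ x := by
      rw [hM, hy, Matrix.mulVec_mulVec, Matrix.mul_assoc, Matrix.nonsing_inv_mul _ hdet, mul_one]
    have h1 : (M *ᵥ y) ⬝ᵥ (P *ᵥ (M *ᵥ y)) - y ⬝ᵥ (P *ᵥ y) ≤ -(1 / 2) * (y ⬝ᵥ y) := by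
      have h := mulVec_dotProduct_self_le (M ^ k) y
      have h0 := dotProduct_self_nonneg' y
      rw [hform, hform, ← Finset.sum_sub_distrib]
      have h2 : ∀ l, (M ^ l *ᵥ (M *ᵥ y)) ⬝ᵥ (M ^ l *ᵥ (M *ᵥ y)) - (M ^ l *ᵥ y) ⬝ᵥ (M ^ l *ᵥ y) =
          (M ^ (l + 1) *ᵥ y) ⬝ᵥ (M ^ (l + 1) *ᵥ y) - (M ^ l *ᵥ y) ⬝ᵥ (M ^ l *ᵥ y) := by
        intro l; rw [Matrix.mulVec_mulVec, ← pow_succ]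
      rw [Finset.sum_congr rfl fun l _ => h2 l,
        Finset.sum_range_sub (fun l => (M ^ l *ᵥ y) ⬝ᵥ (M ^ l *ᵥ y))]
      simp only [pow_zero, Matrix.one_mulVec]
      nlinarith
    -- With y = (1 - A)x and My = (1 + A)x, polarization turns the discrete decrement into the
    -- continuous one.
    have h2 : (M *ᵥ y) ⬝ᵥ (P *ᵥ (M *ᵥ y)) - y ⬝ᵥ (P *ᵥ y) = 4 * (x ⬝ᵥ (P *ᵥ (A *ᵥ x))) := by
      have hs : (A *ᵥ x) ⬝ᵥ (P *ᵥ x) = x ⬝ᵥ (P *ᵥ (A *ᵥ x)) := by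
        rw [hform, hform]; exact Finset.sum_congr rfl fun l _ => dotProduct_comm _ _
      rw [hMy, hy, Matrix.add_mulVec, Matrix.sub_mulVec, Matrix.one_mulVec]
      simp only [Matrix.mulVec_add, Matrix.mulVec_sub, dotProduct_add, add_dotProduct,
        dotProduct_sub, sub_dotProduct, hs]
      ring
    have h3 : x ⬝ᵥ x ≤ (K + 1) * (y ⬝ᵥ y) := by
      have h := mulVec_dotProduct_self_le (1 - A)⁻¹ y
      rw [hy, Matrix.mulVec_mulVec, Matrix.nonsing_inv_mul _ hdet, Matrix.one_mulVec] at h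
      have := dotProduct_self_nonneg' y
      nlinarith
    have h4 : x ⬝ᵥ (P *ᵥ (A *ᵥ x)) ≤ -(1 / 8) * (y ⬝ᵥ y) := by linarith
    have h5 : 1 / (8 * (K + 1)) * (x ⬝ᵥ x) ≤ 1 / 8 * (y ⬝ᵥ y) := by
      rw [div_mul_eq_mul_div, div_le_iff₀ (by positivity)]; linarith
    linarith

end Lyapunov

/-! ### Dissipation inequality, L² gain and decay. -/

section Dissipation

variable {n N : ℕ}

theorem HasDerivAt.dotProduct {x y : ℝ → Fin n → ℝ} {x' y' : Fin n → ℝ} {t : ℝ}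
    (hx : HasDerivAt x x' t) (hy : HasDerivAt y y' t) :
    HasDerivAt (fun s => x s ⬝ᵥ y s) (x' ⬝ᵥ y t + x t ⬝ᵥ y') t := by
  rw [hasDerivAt_pi] at hx hy
  have := HasDerivAt.fun_sum (u := Finset.univ) fun i _ => (hx i).mul (hy i)
  simpa [_root_.dotProduct, Finset.sum_add_distrib] using this

theorem HasDerivAt.mulVec {m : ℕ} (P : Matrix (Fin m) (Fin n) ℝ) {x : ℝ → Fin n → ℝ}
    {x' : Fin n → ℝ} {t : ℝ} (hx : HasDerivAt x x' t) :
    HasDerivAt (fun s => P *ᵥ x s) (P *ᵥ x') t := by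
  rw [hasDerivAt_pi] at hx ⊢
  intro i
  exact HasDerivAt.fun_sum (u := Finset.univ) fun j _ => (hx j).const_mul (P i j)

theorem HasDerivAt.quadratic {P : Matrix (Fin n) (Fin n) ℝ} (hP : Pᵀ = P) {x : ℝ → Fin n → ℝ}
    {x' : Fin n → ℝ} {t : ℝ} (hx : HasDerivAt x x' t) :
    HasDerivAt (fun s => x s ⬝ᵥ (P *ᵥ x s)) (2 * (x t ⬝ᵥ (P *ᵥ x'))) t := by
  convert! hx.dotProduct (hx.mulVec P) using 1
  have h : x' ⬝ᵥ (P *ᵥ x t) = x t ⬝ᵥ (P *ᵥ x') := by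
    rw [Matrix.dotProduct_mulVec x', ← Matrix.mulVec_transpose, hP, dotProduct_comm]
  rw [h, two_mul]

theorem continuous_quadratic (P : Matrix (Fin n) (Fin n) ℝ) :
    Continuous fun x : Fin n → ℝ => x ⬝ᵥ (P *ᵥ x) := by
  fun_prop

theorem continuous_dotProduct_self : Continuous fun x : Fin n → ℝ => x ⬝ᵥ x := by
  fun_prop

/-- Half of the decay rate 2c absorbs the cross term 2u(x·Pb), by Cauchy–Schwarz and the
arithmetic–geometric mean inequality. -/
theorem two_mul_lyapunov_le {A P : Matrix (Fin n) (Fin n) ℝ} {c : ℝ} (hc : 0 < c)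
    (hA : ∀ x, x ⬝ᵥ (P *ᵥ (A *ᵥ x)) ≤ -c * (x ⬝ᵥ x)) (b x : Fin n → ℝ) (u : ℝ) :
    2 * (x ⬝ᵥ (P *ᵥ (A *ᵥ x + u • b))) ≤
      -c * (x ⬝ᵥ x) + (P *ᵥ b) ⬝ᵥ (P *ᵥ b) / c * u ^ 2 := by
  rw [Matrix.mulVec_add, dotProduct_add, Matrix.mulVec_smul, dotProduct_smul, smul_eq_mul]
  have h1 := hA x
  have h2 := dotProduct_sq_le x (P *ᵥ b)
  set X := x ⬝ᵥ x
  set D := (P *ᵥ b) ⬝ᵥ (P *ᵥ b)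
  set z := x ⬝ᵥ (P *ᵥ b)
  have hX : 0 ≤ X := dotProduct_self_nonneg' x
  have hD : 0 ≤ D := dotProduct_self_nonneg' _
  have h3 : 2 * (u * z) ≤ c * X + D / c * u ^ 2 := by
    have h4 : (2 * (u * z)) ^ 2 ≤ (c * X + D / c * u ^ 2) ^ 2 := by
      have : (c * X + D / c * u ^ 2) ^ 2 = (c * X - D / c * u ^ 2) ^ 2 + 4 * (X * D) * u ^ 2 := by
        field_simp; ring
      nlinarith [sq_nonneg (c * X - D / c * u ^ 2), mul_le_mul_of_nonneg_right h2 (sq_nonneg u)]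
    exact (abs_le_of_sq_le_sq' h4 (by positivity)).2
  linarith

/-- Finite `L²` gain of a Hurwitz single-input single-output system from rest. -/
theorem exists_gain (A : Matrix (Fin n) (Fin n) ℝ)
    (hA : ∀ μ : ℂ, Module.End.HasEigenvalue (Matrix.toLin' (A.map (algebraMap ℝ ℂ))) μ → μ.re < 0)
    (b c : Fin n → ℝ) :
    ∃ κ : ℝ, 0 ≤ κ ∧ ∀ (x : ℝ → Fin n → ℝ) (u : ℝ → ℝ), ContinuousOn x (Ici 0) →
      ContinuousOn u (Ici 0) → x 0 = 0 →
      (∀ t, 0 < t → HasDerivAt x (A *ᵥ x t + u t • b) t) →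
      ∀ T, 0 ≤ T → ∫ t in (0 : ℝ)..T, (c ⬝ᵥ x t) ^ 2 ≤ κ * ∫ t in (0 : ℝ)..T, u t ^ 2 := by
  obtain ⟨P, a, ha, hP, hpos, hlyap⟩ := exists_lyapunov_matrix A hA
  set D := (P *ᵥ b) ⬝ᵥ (P *ᵥ b) with hD
  have hD0 : 0 ≤ D := dotProduct_self_nonneg' _
  have hc0 : 0 ≤ c ⬝ᵥ c := dotProduct_self_nonneg' _
  refine ⟨(c ⬝ᵥ c) * (D / a / a), by positivity, fun x u hx hu h0 hd T hT => ?_⟩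
  have hsub : uIcc 0 T ⊆ Ici 0 := by rw [uIcc_of_le hT]; exact fun t ht => ht.1
  have hcx : ContinuousOn (fun t => x t ⬝ᵥ x t) (Ici 0) :=
    continuous_dotProduct_self.comp_continuousOn hx
  have hix : IntervalIntegrable (fun t => x t ⬝ᵥ x t) volume 0 T := (hcx.mono hsub).intervalIntegrable
  have hiu : IntervalIntegrable (fun t => u t ^ 2) volume 0 T :=
    ((hu.pow 2).mono hsub).intervalIntegrable
  have hcd : ContinuousOn (fun t => 2 * (x t ⬝ᵥ (P *ᵥ (A *ᵥ x t + u t • b)))) (Ici 0) := by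
    have : Continuous fun p : (Fin n → ℝ) × ℝ => 2 * (p.1 ⬝ᵥ (P *ᵥ (A *ᵥ p.1 + p.2 • b))) := by
      fun_prop
    exact this.comp_continuousOn (hx.prodMk hu)
  have hftc := intervalIntegral.integral_eq_sub_of_hasDerivAt_of_le hT
    (((continuous_quadratic P).comp_continuousOn hx).mono fun t ht => ht.1)
    (fun t ht => (hd t ht.1).quadratic hP) (hcd.mono hsub).intervalIntegrable
  have hle : ∫ t in (0 : ℝ)..T, 2 * (x t ⬝ᵥ (P *ᵥ (A *ᵥ x t + u t • b))) ≤
      ∫ t in (0 : ℝ)..T, (-a * (x t ⬝ᵥ x t) + D / a * u t ^ 2) :=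
    intervalIntegral.integral_mono_on hT (hcd.mono hsub).intervalIntegrable
      ((hix.const_mul _).add (hiu.const_mul _))
      fun t _ => two_mul_lyapunov_le ha hlyap b (x t) (u t)
  rw [hftc, intervalIntegral.integral_add (hix.const_mul _) (hiu.const_mul _),
    intervalIntegral.integral_const_mul, intervalIntegral.integral_const_mul] at hle
  have hT0 : 0 ≤ x T ⬝ᵥ (P *ᵥ x T) := (dotProduct_self_nonneg' _).trans (hpos _)
  simp only [Function.comp_def, h0, Matrix.mulVec_zero, dotProduct_zero, sub_zero] at hle
  have h1 : ∫ t in (0 : ℝ)..T, x t ⬝ᵥ x t ≤ D / a / a * ∫ t in (0 : ℝ)..T, u t ^ 2 := by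
    have : a * ∫ t in (0 : ℝ)..T, x t ⬝ᵥ x t ≤ D / a * ∫ t in (0 : ℝ)..T, u t ^ 2 := by linarith
    rw [div_mul_eq_mul_div (D / a), le_div_iff₀ ha]; linarith
  have hcc : ContinuousOn (fun t => (c ⬝ᵥ x t) ^ 2) (Ici 0) := by
    have : Continuous fun y : Fin n → ℝ => (c ⬝ᵥ y) ^ 2 := by fun_prop
    exact this.comp_continuousOn hx
  calc ∫ t in (0 : ℝ)..T, (c ⬝ᵥ x t) ^ 2
      ≤ ∫ t in (0 : ℝ)..T, (c ⬝ᵥ c) * (x t ⬝ᵥ x t) :=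
        intervalIntegral.integral_mono_on hT (hcc.mono hsub).intervalIntegrable
          (hix.const_mul _) fun t _ => dotProduct_sq_le c (x t)
    _ = (c ⬝ᵥ c) * ∫ t in (0 : ℝ)..T, x t ⬝ᵥ x t := intervalIntegral.integral_const_mul _ _
    _ ≤ _ := by rw [mul_assoc]; exact mul_le_mul_of_nonneg_left h1 hc0

theorem quadratic_le (P : Matrix (Fin n) (Fin n) ℝ) (x : Fin n → ℝ) :
    x ⬝ᵥ (P *ᵥ x) ≤ (1 + ∑ i, ∑ j, P i j ^ 2) * (x ⬝ᵥ x) := by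
  have h1 := dotProduct_sq_le x (P *ᵥ x)
  have h2 := mulVec_dotProduct_self_le P x
  have hx := dotProduct_self_nonneg' x
  have hy := dotProduct_self_nonneg' (P *ᵥ x)
  nlinarith [sq_nonneg (x ⬝ᵥ x - (P *ᵥ x) ⬝ᵥ (P *ᵥ x)),
    abs_le_of_sq_le_sq' (show (x ⬝ᵥ (P *ᵥ x)) ^ 2 ≤ (x ⬝ᵥ x + (P *ᵥ x) ⬝ᵥ (P *ᵥ x)) ^ 2 by nlinarith)
      (by positivity)]

/-- Exponential decay of finitely many copies of a Hurwitz system under a small coupling. -/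
theorem exists_decay (A : Matrix (Fin n) (Fin n) ℝ)
    (hA : ∀ μ : ℂ, Module.End.HasEigenvalue (Matrix.toLin' (A.map (algebraMap ℝ ℂ))) μ → μ.re < 0)
    (b : Fin n → ℝ) :
    ∃ θ p ε : ℝ, 0 < θ ∧ 0 < p ∧ 0 < ε ∧ ∀ (N : ℕ) (e : ℝ → Fin N → Fin n → ℝ) (u : ℝ → Fin N → ℝ),
      ContinuousOn e (Ici 0) →
      (∀ t, 0 < t → ∀ i, HasDerivAt (fun s => e s i) (A *ᵥ e t i + u t i • b) t) →
      (∀ t, 0 < t → ∑ i, u t i ^ 2 ≤ θ * ∑ i, e t i ⬝ᵥ e t i) →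
      ∀ t, 0 ≤ t → ∑ i, e t i ⬝ᵥ e t i ≤ p * (∑ i, e 0 i ⬝ᵥ e 0 i) * Real.exp (-ε * t) := by
  obtain ⟨P, a, ha, hP, hpos, hlyap⟩ := exists_lyapunov_matrix A hA
  set D := (P *ᵥ b) ⬝ᵥ (P *ᵥ b) with hD
  have hD0 : 0 ≤ D := dotProduct_self_nonneg' _
  set p := 1 + ∑ i, ∑ j, P i j ^ 2 with hp
  have hp0 : 0 < p := add_pos_of_pos_of_nonneg one_pos
    (Finset.sum_nonneg fun i _ => Finset.sum_nonneg fun j _ => sq_nonneg _)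
  refine ⟨a / (2 * (D / a + 1)), p, a / (2 * p), by positivity, hp0, by positivity,
    fun N e u he hd hu t ht => ?_⟩
  set θ := a / (2 * (D / a + 1)) with hθ
  set ε := a / (2 * p) with hε
  -- θ is chosen so that the coupling uses up at most half of the dissipation a; the other half
  -- yields the rate ε = a/(2p), because W ≤ p ∑ |e i|².
  have hDθ : D / a * θ ≤ a / 2 := by
    rw [hθ, mul_div_assoc', div_le_div_iff₀ (by positivity) (by positivity)]
    nlinarith [div_nonneg hD0 ha.le]
  set W : ℝ → ℝ := fun s => ∑ i, e s i ⬝ᵥ (P *ᵥ e s i) with hW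
  have hWc : ContinuousOn W (Ici 0) := by
    have : Continuous fun y : Fin N → Fin n → ℝ => ∑ i, y i ⬝ᵥ (P *ᵥ y i) := by fun_prop
    exact this.comp_continuousOn he
  have hWd : ∀ s, 0 < s →
      HasDerivAt W (∑ i, 2 * (e s i ⬝ᵥ (P *ᵥ (A *ᵥ e s i + u s i • b)))) s := fun s hs =>
    HasDerivAt.fun_sum fun i _ => (hd s hs i).quadratic hP
  have hanti : AntitoneOn (fun s => Real.exp (ε * s) * W s) (Ici 0) := by
    have hder : ∀ s, 0 < s → HasDerivAt (fun s => Real.exp (ε * s) * W s)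
        (Real.exp (ε * s) * ε * W s + Real.exp (ε * s) *
          ∑ i, 2 * (e s i ⬝ᵥ (P *ᵥ (A *ᵥ e s i + u s i • b)))) s := by
      intro s hs
      have h1 : HasDerivAt (fun s : ℝ => Real.exp (ε * s)) (Real.exp (ε * s) * ε) s := by
        simpa using ((hasDerivAt_id s).const_mul ε).exp
      exact h1.mul (hWd s hs)
    refine antitoneOn_of_deriv_nonpos (convex_Ici 0) ?_ ?_ ?_
    · exact (by fun_prop : Continuous fun s : ℝ => Real.exp (ε * s)).continuousOn.mul hWc
    · intro s hs
      rw [interior_Ici] at hs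
      exact (hder s hs).differentiableAt.differentiableWithinAt
    · intro s hs
      rw [interior_Ici] at hs
      rw [(hder s hs).deriv, mul_assoc, ← mul_add]
      refine mul_nonpos_of_nonneg_of_nonpos (Real.exp_pos _).le ?_
      have h1 : ∑ i, 2 * (e s i ⬝ᵥ (P *ᵥ (A *ᵥ e s i + u s i • b))) ≤
          ∑ i, (-a * (e s i ⬝ᵥ e s i) + D / a * u s i ^ 2) :=
        Finset.sum_le_sum fun i _ => two_mul_lyapunov_le ha hlyap b _ _
      rw [Finset.sum_add_distrib, ← Finset.mul_sum _ _ (-a), ← Finset.mul_sum _ _ (D / a)] at h1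
      have h2 : W s ≤ p * ∑ i, e s i ⬝ᵥ e s i := by
        rw [Finset.mul_sum]; exact Finset.sum_le_sum fun i _ => quadratic_le P _
      have hS : 0 ≤ ∑ i, e s i ⬝ᵥ e s i := Finset.sum_nonneg fun i _ => dotProduct_self_nonneg' _
      have h3 : D / a * ∑ i, u s i ^ 2 ≤ a / 2 * ∑ i, e s i ⬝ᵥ e s i := by
        calc D / a * ∑ i, u s i ^ 2 ≤ D / a * (θ * ∑ i, e s i ⬝ᵥ e s i) :=
              mul_le_mul_of_nonneg_left (hu s hs) (by positivity)
          _ = (D / a * θ) * ∑ i, e s i ⬝ᵥ e s i := by ring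
          _ ≤ _ := mul_le_mul_of_nonneg_right hDθ hS
      have h4 : ε * W s ≤ a / 2 * ∑ i, e s i ⬝ᵥ e s i := by
        calc ε * W s ≤ ε * (p * ∑ i, e s i ⬝ᵥ e s i) :=
              mul_le_mul_of_nonneg_left h2 (by positivity)
          _ = _ := by rw [hε]; field_simp
      linarith
  have h1 := hanti (mem_Ici.2 le_rfl) (mem_Ici.2 ht) ht
  simp only [mul_zero, Real.exp_zero, one_mul] at h1
  have h2 : W 0 ≤ p * ∑ i, e 0 i ⬝ᵥ e 0 i := by
    rw [Finset.mul_sum]; exact Finset.sum_le_sum fun i _ => quadratic_le P _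
  have h3 : ∑ i, e t i ⬝ᵥ e t i ≤ W t := Finset.sum_le_sum fun i _ => hpos _
  have h4 : Real.exp (-ε * t) * Real.exp (ε * t) = 1 := by
    rw [← Real.exp_add]; simp
  calc ∑ i, e t i ⬝ᵥ e t i ≤ W t := h3
    _ = Real.exp (-ε * t) * (Real.exp (ε * t) * W t) := by rw [← mul_assoc, h4, one_mul]
    _ ≤ Real.exp (-ε * t) * (p * ∑ i, e 0 i ⬝ᵥ e 0 i) :=
        mul_le_mul_of_nonneg_left (h1.trans h2) (Real.exp_pos _).le
    _ = _ := by ring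

end Dissipation

/-! ### The network equations for a single input and output. -/

namespace Subsystem

variable {n N : ℕ}

/-- The coupling signal entering vertex `i` of a single-input single-output network. -/
def coupling (S : Subsystem n 1) (α : ℝ) (g : Fin N → Fin N → ℝ) (x : Fin N → Fin n → ℝ)
    (i : Fin N) : ℝ :=
  α * ∑ j, g i j * (S.C 0 ⬝ᵥ x j - S.C 0 ⬝ᵥ x i)

theorem networkField_apply (S : Subsystem n 1) (α : ℝ) (g : Fin N → Fin N → ℝ)
    (v : Fin N → Fin 1 → ℝ) (x : Fin N → Fin n → ℝ) (i : Fin N) :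
    S.networkField α g v x i =
      S.A *ᵥ x i + (S.coupling α g x i + v i 0) • fun k => S.B k 0 := by
  unfold networkField coupling
  -- The term j = i vanishes, so the self-weights `g i i` play no role and the sum may run over all
  -- vertices.
  rw [Finset.sum_erase _ (by simp)]
  ext k
  simp [Matrix.mulVec, dotProduct, Finset.sum_apply]
  ring

theorem continuous_coupling (S : Subsystem n 1) (α : ℝ) (g : Fin N → Fin N → ℝ) (i : Fin N) :
    Continuous fun x => S.coupling α g x i := by
  unfold coupling
  fun_prop

theorem energy_eq (S : Subsystem n 1) (x : ℝ → Fin N → Fin n → ℝ) (T : ℝ) (i : Fin N) :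
    S.energy x T i = ∫ t in (0 : ℝ)..T, (S.C 0 ⬝ᵥ x t i) ^ 2 := by
  simp [energy, Matrix.mulVec, dotProduct, pow_two]

/-- A vertex without external input has a continuous right-hand side, so there the integral equation
gives a classical derivative even if the disturbance jumps elsewhere. Integrability of the inputs is
needed to take a component of the vector-valued integral. -/
theorem IsTrajectory.hasDerivAt {S : Subsystem n 1} {α : ℝ} {g : Fin N → Fin N → ℝ}
    {v : ℝ → Fin N → Fin 1 → ℝ} {x : ℝ → Fin N → Fin n → ℝ} (hx : S.IsTrajectory α g v x)
    (hv : ∀ i, ∀ T, 0 < T → IntegrableOn (fun t => v t i 0) (Icc 0 T)) {i : Fin N}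
    (hi : ∀ t, v t i 0 = 0) {t : ℝ} (ht : 0 < t) :
    HasDerivAt (fun s => x s i) (S.A *ᵥ x t i + S.coupling α g (x t) i • fun k => S.B k 0) t := by
  have hint : ∀ T, 0 ≤ T →
      IntervalIntegrable (fun τ => S.networkField α g (v τ) (x τ)) volume 0 T := by
    intro T hT
    rcases hT.eq_or_lt with rfl | hT
    · exact IntervalIntegrable.refl
    rw [intervalIntegrable_iff_integrableOn_Icc_of_le hT.le]
    refine Integrable.of_eval fun j => Integrable.of_eval fun k => ?_
    simp only [networkField_apply, Pi.add_apply, Pi.smul_apply, smul_eq_mul, add_mul]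
    refine Integrable.add ?_ (Integrable.add ?_ ((hv j T hT).mul_const _))
    · have : Continuous fun y : Fin N → Fin n → ℝ => (S.A *ᵥ y j) k :=
        (continuous_apply k).comp (by fun_prop : Continuous fun y : Fin N → Fin n → ℝ => S.A *ᵥ y j)
      exact ((this.comp_continuousOn hx.1).mono Icc_subset_Ici_self).integrableOn_Icc
    · exact ((((S.continuous_coupling α g j).comp_continuousOn hx.1).mul
        continuousOn_const).mono Icc_subset_Ici_self).integrableOn_Icc
  set f : ℝ → Fin n → ℝ := fun τ => S.A *ᵥ x τ i + S.coupling α g (x τ) i • fun k => S.B k 0 with hf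
  have hfc : ContinuousOn f (Ici 0) := by
    have : Continuous fun y : Fin N → Fin n → ℝ =>
        S.A *ᵥ y i + S.coupling α g y i • fun k => S.B k 0 :=
      (by fun_prop : Continuous fun y : Fin N → Fin n → ℝ => S.A *ᵥ y i).add
        ((S.continuous_coupling α g i).smul continuous_const)
    exact this.comp_continuousOn hx.1
  have hcomp : ∀ T, 0 ≤ T → x T i = x 0 i + ∫ τ in (0 : ℝ)..T, f τ := by
    intro T hT
    have h1 := congrFun (hx.2 T hT) i
    rw [h1, Pi.add_apply]
    congr 1
    have h2 := (ContinuousLinearMap.proj (R := ℝ) (φ := fun _ : Fin N => Fin n → ℝ)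
      i).intervalIntegral_comp_comm (hint T hT)
    simp only [ContinuousLinearMap.proj_apply] at h2
    rw [← h2]
    refine intervalIntegral.integral_congr fun τ _ => ?_
    simp [networkField_apply, hi, hf]
  have hd : HasDerivAt (fun T => x 0 i + ∫ τ in (0 : ℝ)..T, f τ) (f t) t := by
    refine HasDerivAt.const_add _ (intervalIntegral.integral_hasDerivAt_right ?_ ?_ ?_)
    · refine (hfc.mono ?_).intervalIntegrable
      rw [uIcc_of_le ht.le]; exact Icc_subset_Ici_self
    · exact (hfc.mono Ioi_subset_Ici_self).stronglyMeasurableAtFilter isOpen_Ioi t ht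
    · exact hfc.continuousAt (Ici_mem_nhds ht)
  refine hd.congr_of_eventuallyEq ?_
  filter_upwards [Ioi_mem_nhds ht] with T hT
  exact hcomp T (le_of_lt hT)

end Subsystem

/-! ### Part (ii): small gain and synchronization under weak coupling. -/

namespace Subsystem

variable {n N : ℕ}

theorem energy_nonneg (S : Subsystem n 1) (x : ℝ → Fin N → Fin n → ℝ) {T : ℝ} (hT : 0 ≤ T)
    (i : Fin N) : 0 ≤ S.energy x T i := by
  rw [energy_eq]
  exact intervalIntegral.integral_nonneg hT fun t _ => sq_nonneg _

theorem sum_sq_weight_le (g : Fin N → Fin N → ℝ) (b : Fin N) :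
    ∑ j, g b j ^ 2 ≤ ∑ i, ∑ j, g i j ^ 2 :=
  Finset.single_le_sum (f := fun i => ∑ j, g i j ^ 2)
    (fun _ _ => Finset.sum_nonneg fun _ _ => sq_nonneg _) (Finset.mem_univ b)

/-- Small gain at a vertex `b` of maximal energy in `VB`: if the claim failed, the inputs of `b`
would come only from vertices with at most its energy, so E_b ≤ α²K E_b ≤ E_b/2 and E_b could not be
positive. -/
theorem StrictlyStable.exists_energy_le {S : Subsystem n 1} (hS : S.StrictlyStable)
    (g : Fin N → Fin N → ℝ) (hg : ∀ i j, i ≠ j → 0 ≤ g i j) :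
    ∃ K : ℝ, 0 ≤ K ∧ ∀ α : ℝ, α ^ 2 * K ≤ 1 / 2 →
      ∀ (s : Fin N) (w : ℝ → Fin 1 → ℝ), (∀ k, SatisfiesDirichlet (fun t => w t k)) →
      ∀ x : ℝ → Fin N → Fin n → ℝ, S.IsDisturbanceResponse α g s w x →
      ∀ (VC V1 VB : Finset (Fin N)) (h : IsSeparatingCutset g s VC V1 VB) (T : ℝ), 0 < T →
      ∀ b ∈ VB, S.energy x T b ≤ VC.sup' h.nonempty (fun v => S.energy x T v) := by
  obtain ⟨κ, hκ, hgain⟩ := exists_gain S.A hS (fun k => S.B k 0) (S.C 0)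
  set G := ∑ i, ∑ j, g i j ^ 2 with hG
  have hG0 : 0 ≤ G := Finset.sum_nonneg fun i _ => Finset.sum_nonneg fun j _ => sq_nonneg _
  refine ⟨κ * (G * (4 * N)), by positivity, fun α hα s w hw x hx VC V1 VB h T hT b₀ hb₀ => ?_⟩
  set m := VC.sup' h.nonempty (fun v => S.energy x T v) with hm
  obtain ⟨b, hb, hbmax⟩ := VB.exists_max_image (S.energy x T) ⟨b₀, hb₀⟩
  refine (hbmax b₀ hb₀).trans ?_
  by_contra! hlt
  have hm0 : 0 ≤ m := by
    obtain ⟨c, hc⟩ := h.nonempty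
    exact (S.energy_nonneg x hT.le c).trans (Finset.le_sup' (fun v => S.energy x T v) hc)
  have hsb : b ≠ s := by
    rintro rfl
    rcases Finset.mem_union.1 h.source_mem with h1 | h1
    · exact Finset.disjoint_left.1 h.disjoint h1 hb
    · have : b ∈ Finset.univ \ VC := h.union_eq ▸ Finset.mem_union_right _ hb
      exact (Finset.mem_sdiff.1 this).2 h1
  -- This covers both `VC`, by the assumption to be refuted, and `VB`, by maximality; `V1` remains
  -- uncontrolled but sends no edge to `b`.
  have hle : ∀ j, j ∉ V1 → S.energy x T j ≤ S.energy x T b := by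
    intro j hj
    by_cases hjC : j ∈ VC
    · exact (Finset.le_sup' (fun v => S.energy x T v) hjC).trans hlt.le
    · have : j ∈ V1 ∪ VB := h.union_eq ▸ Finset.mem_sdiff.2 ⟨Finset.mem_univ _, hjC⟩
      rcases Finset.mem_union.1 this with h1 | h1
      · exact absurd h1 hj
      · exact hbmax j h1
  have hzero : ∀ j ∈ V1, g b j = 0 := by
    intro j hj
    have hjb : b ≠ j := by
      rintro rfl; exact Finset.disjoint_left.1 h.disjoint hj hb
    exact le_antisymm (not_lt.1 (h.no_edge j hj b hb)) (hg b j hjb)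
  have hc := hx.1.1
  have hder : ∀ t, 0 < t → HasDerivAt (fun τ => x τ b)
      (S.A *ᵥ x t b + S.coupling α g (x t) b • fun k => S.B k 0) t := by
    intro t ht
    refine hx.1.hasDerivAt (fun i T hT => ?_) (fun t => by simp [hsb]) ht
    by_cases his : i = s
    · subst his; simpa using (hw 0).integrable T hT
    · simp [his]
  have hxc : ∀ j, ContinuousOn (fun τ => x τ j) (Ici 0) := fun j =>
    (continuous_apply j).comp_continuousOn hc
  have hE := hgain (fun τ => x τ b) (fun τ => S.coupling α g (x τ) b) (hxc b)
    ((S.continuous_coupling α g b).comp_continuousOn hc) (by simp [hx.2]) hder T hT.le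
  rw [← energy_eq] at hE
  have hii : ∀ j, IntervalIntegrable (fun t => (S.C 0 ⬝ᵥ x t j) ^ 2) volume 0 T := by
    intro j
    have : Continuous fun y : Fin n → ℝ => (S.C 0 ⬝ᵥ y) ^ 2 := by fun_prop
    refine ((this.comp_continuousOn (hxc j)).mono ?_).intervalIntegrable
    rw [uIcc_of_le hT.le]; exact Icc_subset_Ici_self
  have hpt : ∀ t, S.coupling α g (x t) b ^ 2 ≤ α ^ 2 * G *
      ∑ j ∈ Finset.univ \ V1, (2 * (S.C 0 ⬝ᵥ x t j) ^ 2 + 2 * (S.C 0 ⬝ᵥ x t b) ^ 2) := by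
    intro t
    have h1 : ∑ j, g b j * (S.C 0 ⬝ᵥ x t j - S.C 0 ⬝ᵥ x t b) =
        ∑ j ∈ Finset.univ \ V1, g b j * (S.C 0 ⬝ᵥ x t j - S.C 0 ⬝ᵥ x t b) := by
      symm
      refine Finset.sum_subset (Finset.subset_univ _) fun j _ hj => ?_
      have : j ∈ V1 := by simpa using hj
      rw [hzero j this, zero_mul]
    rw [coupling, h1, mul_pow, mul_assoc]
    refine mul_le_mul_of_nonneg_left ?_ (sq_nonneg α)
    refine (Finset.sum_mul_sq_le_sq_mul_sq _ _ _).trans ?_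
    refine mul_le_mul ?_ ?_ (Finset.sum_nonneg fun j _ => sq_nonneg _) hG0
    · exact (Finset.sum_le_sum_of_subset_of_nonneg (Finset.subset_univ _)
        fun j _ _ => sq_nonneg _).trans (sum_sq_weight_le g b)
    · refine Finset.sum_le_sum fun j _ => ?_
      nlinarith [sq_nonneg (S.C 0 ⬝ᵥ x t j + S.C 0 ⬝ᵥ x t b)]
  have hcu : IntervalIntegrable (fun t => S.coupling α g (x t) b ^ 2) volume 0 T := by
    refine ((((S.continuous_coupling α g b).comp_continuousOn hc).pow 2).mono ?_).intervalIntegrable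
    rw [uIcc_of_le hT.le]; exact Icc_subset_Ici_self
  have hsum : IntervalIntegrable (fun t => ∑ j ∈ Finset.univ \ V1,
      (2 * (S.C 0 ⬝ᵥ x t j) ^ 2 + 2 * (S.C 0 ⬝ᵥ x t b) ^ 2)) volume 0 T := by
    have := IntervalIntegrable.sum (Finset.univ \ V1) fun j _ =>
      ((hii j).const_mul 2).add ((hii b).const_mul 2)
    convert! this using 1
    ext t
    simp [Finset.sum_apply]
  have hu : ∫ t in (0 : ℝ)..T, S.coupling α g (x t) b ^ 2 ≤
      α ^ 2 * G * (4 * N * S.energy x T b) := by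
    calc ∫ t in (0 : ℝ)..T, S.coupling α g (x t) b ^ 2
        ≤ ∫ t in (0 : ℝ)..T, α ^ 2 * G * ∑ j ∈ Finset.univ \ V1,
            (2 * (S.C 0 ⬝ᵥ x t j) ^ 2 + 2 * (S.C 0 ⬝ᵥ x t b) ^ 2) :=
          intervalIntegral.integral_mono_on hT.le hcu
            (hsum.const_mul _) fun t _ => hpt t
      _ = α ^ 2 * G * ∑ j ∈ Finset.univ \ V1, (2 * S.energy x T j + 2 * S.energy x T b) := by
          rw [intervalIntegral.integral_const_mul, intervalIntegral.integral_finsetSum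
            fun j _ => ((hii j).const_mul 2).add ((hii b).const_mul 2)]
          congr 1
          refine Finset.sum_congr rfl fun j _ => ?_
          rw [intervalIntegral.integral_add ((hii j).const_mul 2) ((hii b).const_mul 2),
            intervalIntegral.integral_const_mul, intervalIntegral.integral_const_mul,
            energy_eq, energy_eq]
      _ ≤ α ^ 2 * G * (4 * N * S.energy x T b) := by
          refine mul_le_mul_of_nonneg_left ?_ (by positivity)
          calc ∑ j ∈ Finset.univ \ V1, (2 * S.energy x T j + 2 * S.energy x T b)
              ≤ ∑ j ∈ Finset.univ \ V1, 4 * S.energy x T b := by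
                refine Finset.sum_le_sum fun j hj => ?_
                have := hle j (Finset.mem_sdiff.1 hj).2
                linarith
            _ ≤ ∑ _j : Fin N, 4 * S.energy x T b :=
                Finset.sum_le_sum_of_subset_of_nonneg (Finset.subset_univ _)
                  fun j _ _ => mul_nonneg (by norm_num) (S.energy_nonneg x hT.le b)
            _ = _ := by simp; ring
  have hb0 : m < S.energy x T b := hlt
  have h1 := mul_le_mul_of_nonneg_left hu hκ
  have h2 := mul_le_mul_of_nonneg_right hα (S.energy_nonneg x hT.le b)
  have h3 : κ * (α ^ 2 * G * (4 * N * S.energy x T b)) =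
      α ^ 2 * (κ * (G * (4 * N))) * S.energy x T b := by ring
  linarith

theorem const_mem_syncManifold (y : Fin n → ℝ) : (fun _ => y) ∈ syncManifold N n :=
  fun _ _ => rfl

theorem dist_le_of_infDist_lt {x : Fin N → Fin n → ℝ} {δ : ℝ}
    (h : Metric.infDist x (syncManifold N n) < δ) (i j : Fin N) (k : Fin n) :
    |x i k - x j k| ≤ 2 * δ := by
  obtain ⟨s, hs, hd⟩ := (Metric.infDist_lt_iff ⟨fun _ => 0, const_mem_syncManifold 0⟩).1 h
  have h1 : ∀ l, |x l k - s l k| ≤ δ := fun l =>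
    ((dist_le_pi_dist (x l) (s l) k).trans (dist_le_pi_dist x s l)).trans hd.le
  have h2 : s i k = s j k := by rw [hs i j]
  have h3 := abs_le.1 (h1 i)
  have h4 := abs_le.1 (h1 j)
  rw [abs_le]
  constructor <;> linarith

theorem sq_infDist_le (x : Fin N → Fin n → ℝ) (i₀ : Fin N) :
    Metric.infDist x (syncManifold N n) ^ 2 ≤ ∑ i, (x i - x i₀) ⬝ᵥ (x i - x i₀) := by
  set R := ∑ i, (x i - x i₀) ⬝ᵥ (x i - x i₀) with hR
  have hR0 : 0 ≤ R := Finset.sum_nonneg fun i _ => dotProduct_self_nonneg' _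
  have h1 : dist x (fun _ => x i₀) ≤ √R := by
    refine (dist_pi_le_iff (Real.sqrt_nonneg _)).2 fun i => (dist_pi_le_iff (Real.sqrt_nonneg _)).2
      fun k => ?_
    rw [Real.dist_eq]
    refine Real.abs_le_sqrt ?_
    calc (x i k - x i₀ k) ^ 2 ≤ (x i - x i₀) ⬝ᵥ (x i - x i₀) := by
          rw [pow_two]
          exact Finset.single_le_sum (f := fun k => (x i - x i₀) k * (x i - x i₀) k)
            (fun k _ => mul_self_nonneg _) (Finset.mem_univ k)
      _ ≤ R := Finset.single_le_sum (f := fun i => (x i - x i₀) ⬝ᵥ (x i - x i₀))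
          (fun i _ => dotProduct_self_nonneg' _) (Finset.mem_univ i)
  have h2 := (Metric.infDist_le_dist_of_mem (const_mem_syncManifold (N := N) (x i₀))).trans h1
  calc Metric.infDist x (syncManifold N n) ^ 2 ≤ √R ^ 2 :=
        pow_le_pow_left₀ Metric.infDist_nonneg h2 2
    _ = R := Real.sq_sqrt hR0

/-- The coupling depends only on output differences, so it is controlled by the deviation from the
reference vertex `i₀`. The factor α² is what makes it small. -/
theorem sum_coupling_sub_sq_le (S : Subsystem n 1) (α : ℝ) (g : Fin N → Fin N → ℝ)
    (x : Fin N → Fin n → ℝ) (i₀ : Fin N) :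
    ∑ i, (S.coupling α g x i - S.coupling α g x i₀) ^ 2 ≤
      α ^ 2 * (8 * N * (N + 1) * (∑ i, ∑ j, g i j ^ 2) * (S.C 0 ⬝ᵥ S.C 0)) *
        ∑ i, (x i - x i₀) ⬝ᵥ (x i - x i₀) := by
  set G := ∑ i, ∑ j, g i j ^ 2 with hG
  set R := ∑ i, (x i - x i₀) ⬝ᵥ (x i - x i₀) with hR
  set d := S.C 0 ⬝ᵥ S.C 0 with hd
  have hR0 : 0 ≤ R := Finset.sum_nonneg fun i _ => dotProduct_self_nonneg' _
  have hd0 : 0 ≤ d := dotProduct_self_nonneg' _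
  have hG0 : 0 ≤ G := Finset.sum_nonneg fun i _ => Finset.sum_nonneg fun j _ => sq_nonneg _
  have hone : ∀ i, (x i - x i₀) ⬝ᵥ (x i - x i₀) ≤ R := fun i =>
    Finset.single_le_sum (f := fun i => (x i - x i₀) ⬝ᵥ (x i - x i₀))
      (fun i _ => dotProduct_self_nonneg' _) (Finset.mem_univ i)
  have hu : ∀ i, S.coupling α g x i ^ 2 ≤ α ^ 2 * (G * (2 * (N + 1) * d * R)) := by
    intro i
    rw [coupling, mul_pow]
    refine mul_le_mul_of_nonneg_left ?_ (sq_nonneg α)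
    refine (Finset.sum_mul_sq_le_sq_mul_sq _ _ _).trans ?_
    refine mul_le_mul (sum_sq_weight_le g i) ?_ (Finset.sum_nonneg fun j _ => sq_nonneg _) hG0
    have h1 : ∀ j, (S.C 0 ⬝ᵥ x j - S.C 0 ⬝ᵥ x i) ^ 2 ≤
        2 * d * ((x j - x i₀) ⬝ᵥ (x j - x i₀)) + 2 * d * R := by
      intro j
      have e : S.C 0 ⬝ᵥ x j - S.C 0 ⬝ᵥ x i =
          S.C 0 ⬝ᵥ (x j - x i₀) - S.C 0 ⬝ᵥ (x i - x i₀) := by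
        simp only [dotProduct_sub]; ring
      rw [e]
      have h2 := dotProduct_sq_le (S.C 0) (x j - x i₀)
      have h3 := (dotProduct_sq_le (S.C 0) (x i - x i₀)).trans
        (mul_le_mul_of_nonneg_left (hone i) hd0)
      nlinarith [sq_nonneg (S.C 0 ⬝ᵥ (x j - x i₀) + S.C 0 ⬝ᵥ (x i - x i₀))]
    refine (Finset.sum_le_sum fun j _ => h1 j).trans (le_of_eq ?_)
    rw [Finset.sum_add_distrib, ← Finset.mul_sum _ _ (2 * d), ← hR]
    simp
    ring
  calc ∑ i, (S.coupling α g x i - S.coupling α g x i₀) ^ 2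
      ≤ ∑ _i : Fin N, 4 * (α ^ 2 * (G * (2 * (N + 1) * d * R))) := by
        refine Finset.sum_le_sum fun i _ => ?_
        nlinarith [hu i, hu i₀, sq_nonneg (S.coupling α g x i + S.coupling α g x i₀)]
    _ = _ := by simp; ring

theorem StrictlyStable.exists_syncManifoldAsymptoticallyStable {S : Subsystem n 1}
    (hS : S.StrictlyStable) (g : Fin N → Fin N → ℝ) :
    ∃ K : ℝ, 0 ≤ K ∧ ∀ α : ℝ, α ^ 2 * K ≤ 1 / 2 → S.SyncManifoldAsymptoticallyStable α g := by
  -- Without vertices there is no reference vertex `i₀`, but then every state is synchronous.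
  rcases N.eq_zero_or_pos with rfl | hN
  · refine ⟨0, le_rfl, fun α _ => ?_⟩
    have h0 : ∀ y : Fin 0 → Fin n → ℝ, Metric.infDist y (syncManifold 0 n) = 0 := fun y =>
      Metric.infDist_zero_of_mem fun i => i.elim0
    refine ⟨fun ε hε => ⟨1, one_pos, fun x _ _ t _ => by rwa [h0]⟩,
      1, one_pos, fun x _ _ => by simp [h0]⟩
  obtain ⟨θ, p, ε, hθ, hp, hε, hdecay⟩ := exists_decay S.A hS (fun k => S.B k 0)
  let i₀ : Fin N := ⟨0, hN⟩
  set K := 8 * N * (N + 1) * (∑ i, ∑ j, g i j ^ 2) * (S.C 0 ⬝ᵥ S.C 0) with hK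
  have hK0 : 0 ≤ K := by
    have h1 : 0 ≤ ∑ i, ∑ j, g i j ^ 2 :=
      Finset.sum_nonneg fun i _ => Finset.sum_nonneg fun j _ => sq_nonneg _
    have h2 := dotProduct_self_nonneg' (S.C 0)
    positivity
  refine ⟨K / θ, by positivity, fun α hα => ?_⟩
  have hαK : α ^ 2 * K ≤ θ := by
    have : α ^ 2 * K = α ^ 2 * (K / θ) * θ := by field_simp
    rw [this]; nlinarith
  have key : ∀ x : ℝ → Fin N → Fin n → ℝ, S.IsTrajectory α g (fun _ => 0) x → ∀ δ,
      Metric.infDist (x 0) (syncManifold N n) < δ → ∀ t, 0 ≤ t →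
      Metric.infDist (x t) (syncManifold N n) ^ 2 ≤
        p * (N * n * (2 * δ) ^ 2) * Real.exp (-ε * t) := by
    intro x hx δ hδ t ht
    have h1 := hdecay N (fun s i => x s i - x s i₀)
      (fun s i => S.coupling α g (x s) i - S.coupling α g (x s) i₀)
      ((by fun_prop : Continuous fun y : Fin N → Fin n → ℝ => fun i => y i - y i₀).comp_continuousOn
        hx.1)
      (fun s hs i => by
        have hd := fun j => hx.hasDerivAt (i := j) (fun i T _ => by simp) (fun t => rfl) hs
        convert! (hd i).sub (hd i₀) using 1
        rw [Matrix.mulVec_sub, sub_smul]; abel)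
      (fun s _ => (S.sum_coupling_sub_sq_le α g (x s) i₀).trans
        (mul_le_mul_of_nonneg_right hαK (Finset.sum_nonneg fun i _ => dotProduct_self_nonneg' _)))
      t ht
    refine (sq_infDist_le (x t) i₀).trans (h1.trans ?_)
    refine mul_le_mul_of_nonneg_right (mul_le_mul_of_nonneg_left ?_ hp.le) (Real.exp_pos _).le
    calc ∑ i, (x 0 i - x 0 i₀) ⬝ᵥ (x 0 i - x 0 i₀)
        ≤ ∑ _i : Fin N, ∑ _k : Fin n, (2 * δ) ^ 2 := by
          refine Finset.sum_le_sum fun i _ => Finset.sum_le_sum fun k _ => ?_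
          rw [← pow_two, ← sq_abs]
          exact pow_le_pow_left₀ (abs_nonneg _) (dist_le_of_infDist_lt hδ i i₀ k) 2
      _ = _ := by simp; ring
  refine ⟨fun η hη => ?_, 1, one_pos, fun x hx hx0 => ?_⟩
  -- With q = pNn, this δ turns the bound q(2δ)² into q/(q + 1)² · η², which is strictly less than
  -- η².
  · refine ⟨η / (2 * (p * (N * n) + 1)), by positivity, fun x hx hx0 t ht => ?_⟩
    have h1 := key x hx _ hx0 t ht
    set q := p * (N * n) with hq
    have hq0 : 0 ≤ q := by positivity
    have h2 : Real.exp (-ε * t) ≤ 1 := Real.exp_le_one_iff.2 (by nlinarith)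
    have h3 : p * (N * n * (2 * (η / (2 * (q + 1)))) ^ 2) = q / (q + 1) ^ 2 * η ^ 2 := by
      rw [hq]; field_simp
    rw [h3] at h1
    have h4 : q / (q + 1) ^ 2 < 1 := by rw [div_lt_one (by positivity)]; nlinarith
    have h5 : Metric.infDist (x t) (syncManifold N n) ^ 2 < η ^ 2 := by
      calc _ ≤ q / (q + 1) ^ 2 * η ^ 2 * Real.exp (-ε * t) := h1
        _ ≤ q / (q + 1) ^ 2 * η ^ 2 * 1 := mul_le_mul_of_nonneg_left h2 (by positivity)
        _ < η ^ 2 := by nlinarith [pow_pos hη 2]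
    exact lt_of_pow_lt_pow_left₀ 2 hη.le h5
  · have h1 : Tendsto (fun t => p * (N * n * (2 * 1) ^ 2) * Real.exp (-ε * t)) atTop (𝓝 0) := by
      have h2 : Tendsto (fun t : ℝ => -ε * t) atTop atBot :=
        tendsto_id.const_mul_atTop_of_neg (by linarith)
      simpa using (Real.tendsto_exp_atBot.comp h2).const_mul (p * (N * n * (2 * 1) ^ 2))
    have h2 : Tendsto (fun t => Metric.infDist (x t) (syncManifold N n) ^ 2) atTop (𝓝 0) :=
      squeeze_zero' (Eventually.of_forall fun t => sq_nonneg _)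
        ((eventually_ge_atTop 0).mono fun t ht => key x hx 1 hx0 t ht) h1
    have h3 := (Real.continuous_sqrt.tendsto 0).comp h2
    simpa [Function.comp_def, Real.sqrt_sq Metric.infDist_nonneg] using h3

theorem StrictlyStable.exists_propagationStable {S : Subsystem n 1} (hS : S.StrictlyStable)
    (g : Fin N → Fin N → ℝ) (hg : ∀ i j, i ≠ j → 0 ≤ g i j) :
    ∃ αbar : ℝ, 0 < αbar ∧ ∀ α : ℝ, 0 ≤ α → α ≤ αbar → PropagationStable S α g := by
  obtain ⟨K₁, hK₁, h₁⟩ := hS.exists_syncManifoldAsymptoticallyStable g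
  obtain ⟨K₂, hK₂, h₂⟩ := hS.exists_energy_le g hg
  -- The summand 1 forces α ≤ 1, hence α² ≤ α, and one threshold serves both conditions.
  have hsmall : ∀ α, 0 ≤ α → α ≤ 1 / (2 * (K₁ + K₂ + 1)) → α ^ 2 * (K₁ + K₂ + 1) ≤ 1 / 2 := by
    intro α h0 h1
    rw [le_div_iff₀ (by positivity)] at h1
    have : α ≤ 1 := by nlinarith
    nlinarith
  refine ⟨1 / (2 * (K₁ + K₂ + 1)), by positivity, fun α h0 h1 => ⟨h₁ α ?_, h₂ α ?_⟩⟩ <;>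
    nlinarith [hsmall α h0 h1, sq_nonneg α, mul_nonneg (sq_nonneg α) hK₁,
      mul_nonneg (sq_nonneg α) hK₂]

end Subsystem

/-! ### Reachability with piecewise constant inputs. -/

section StepInputs

variable {V : Type*} [NormedAddCommGroup V] [NormedSpace ℝ V]

/-- `x` is a response of `ẋ = L x + w b` to the scalar input `w`, which is constant on every
interval avoiding the finite set `F`. -/
structure IsStepResponse (L : V →L[ℝ] V) (b : V) (F : Finset ℝ) (w : ℝ → ℝ) (x : ℝ → V) :
    Prop where
  continuous : Continuous x
  hasDerivAt : ∀ t, t ∉ F → HasDerivAt x (L (x t) + w t • b) t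
  const : ∀ p q : ℝ, (∀ t ∈ Ioo p q, t ∉ F) → ∀ s ∈ Ioo p q, ∀ t ∈ Ioo p q, w s = w t
  bounded : ∃ M : ℝ, ∀ t, |w t| ≤ M
  measurable : Measurable w

namespace IsStepResponse

variable {L : V →L[ℝ] V} {b : V} {F G : Finset ℝ} {w w' : ℝ → ℝ} {x x' : ℝ → V}

theorem add (h : IsStepResponse L b F w x) (h' : IsStepResponse L b G w' x') :
    IsStepResponse L b (F ∪ G) (fun t => w t + w' t) (fun t => x t + x' t) where
  continuous := h.continuous.add h'.continuous
  hasDerivAt t ht := by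
    rw [Finset.mem_union, not_or] at ht
    convert! (h.hasDerivAt t ht.1).add (h'.hasDerivAt t ht.2) using 1
    rw [map_add, add_smul]; abel
  const p q hF s hs t ht := by
    rw [h.const p q (fun r hr hrF => hF r hr (Finset.mem_union_left _ hrF)) s hs t ht,
      h'.const p q (fun r hr hrF => hF r hr (Finset.mem_union_right _ hrF)) s hs t ht]
  bounded := by
    obtain ⟨M, hM⟩ := h.bounded
    obtain ⟨M', hM'⟩ := h'.bounded
    exact ⟨M + M', fun t => (abs_add_le _ _).trans (add_le_add (hM t) (hM' t))⟩
  measurable := h.measurable.add h'.measurable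

theorem const_smul (h : IsStepResponse L b F w x) (r : ℝ) :
    IsStepResponse L b F (fun t => r * w t) (fun t => r • x t) where
  continuous := h.continuous.const_smul r
  hasDerivAt t ht := by
    convert! (h.hasDerivAt t ht).const_smul r using 1
    rw [map_smul, smul_add, smul_smul]
  const p q hF s hs t ht := by rw [h.const p q hF s hs t ht]
  bounded := by
    obtain ⟨M, hM⟩ := h.bounded
    exact ⟨|r| * M, fun t => by
      rw [abs_mul]; exact mul_le_mul_of_nonneg_left (hM t) (abs_nonneg r)⟩
  measurable := h.measurable.const_mul r

theorem of_free (hx : ∀ t, HasDerivAt x (L (x t)) t) :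
    IsStepResponse L b ∅ (fun _ => 0) x where
  continuous := continuous_iff_continuousAt.2 fun t => (hx t).continuousAt
  hasDerivAt t _ := by simpa using hx t
  const _ _ _ _ _ _ _ := rfl
  bounded := ⟨0, by simp⟩
  measurable := measurable_const

/-- Switching from one response to another at a time when the states agree. -/
theorem glue (h : IsStepResponse L b F w x) (h' : IsStepResponse L b G w' x') {r : ℝ}
    (hr : x r = x' r) :
    IsStepResponse L b (insert r (F ∪ G)) (fun t => if t ≤ r then w t else w' t)
      (fun t => if t ≤ r then x t else x' t) where
  continuous := Continuous.if_le h.continuous h'.continuous continuous_id continuous_const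
    fun t ht => by rw [show t = r from ht, hr]
  hasDerivAt t ht := by
    simp only [Finset.mem_insert, Finset.mem_union, not_or] at ht
    rcases lt_or_gt_of_ne ht.1 with htr | htr
    · simp only [htr.le, if_true]
      refine (h.hasDerivAt t ht.2.1).congr_of_eventuallyEq ?_
      filter_upwards [Iio_mem_nhds htr] with s hs
      simp [le_of_lt (mem_Iio.1 hs)]
    · simp only [not_le.2 htr, if_false]
      refine (h'.hasDerivAt t ht.2.2).congr_of_eventuallyEq ?_
      filter_upwards [Ioi_mem_nhds htr] with s hs
      simp [not_le.2 (mem_Ioi.1 hs)]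
  const p q hF s hs t ht := by
    have hF1 := h.const p q fun r hr hrF => hF r hr (by simp [hrF])
    have hF2 := h'.const p q fun r hr hrF => hF r hr (by simp [hrF])
    have hrp : r ∉ Ioo p q := fun hrp => hF r hrp (by simp)
    by_cases hrq : q ≤ r
    · simp only [hs.2.le.trans hrq, ht.2.le.trans hrq, if_true]
      exact hF1 s hs t ht
    · have hrp' : r ≤ p := by
        by_contra! h1
        exact hrp ⟨h1, not_le.1 hrq⟩
      simp only [not_le.2 (hrp'.trans_lt hs.1), not_le.2 (hrp'.trans_lt ht.1), if_false]
      exact hF2 s hs t ht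
  bounded := by
    obtain ⟨M, hM⟩ := h.bounded
    obtain ⟨M', hM'⟩ := h'.bounded
    refine ⟨max M M', fun t => ?_⟩
    split_ifs
    · exact (hM t).trans (le_max_left _ _)
    · exact (hM' t).trans (le_max_right _ _)
  measurable := Measurable.ite measurableSet_Iic h.measurable h'.measurable

theorem exists_Ioo_avoiding (F : Finset ℝ) {t : ℝ} (ht : t ∉ F) :
    ∃ p q, t ∈ Ioo p q ∧ ∀ s ∈ Ioo p q, s ∉ F := by
  have h1 : (F : Set ℝ)ᶜ ∈ 𝓝 t := F.finite_toSet.isClosed.isOpen_compl.mem_nhds (by simpa using ht)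
  obtain ⟨p, q, hpq, hs⟩ := mem_nhds_iff_exists_Ioo_subset.1 h1
  exact ⟨p, q, hpq, fun s hsq => by simpa using hs hsq⟩

theorem integrableOn (h : IsStepResponse L b F w x) (T : ℝ) : IntegrableOn w (Icc 0 T) := by
  obtain ⟨M, hM⟩ := h.bounded
  exact Measure.integrableOn_of_bounded (M := M) (by simp) h.measurable.aestronglyMeasurable
    (Eventually.of_forall hM)

theorem satisfiesDirichlet (h : IsStepResponse L b F w x) : SatisfiesDirichlet w where
  integrable T _ := h.integrableOn T
  bounded T _ := by
    obtain ⟨M, hM⟩ := h.bounded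
    exact ⟨M, fun t _ => hM t⟩
  finite_discontinuities T _ := by
    refine F.finite_toSet.subset fun t ht => ?_
    by_contra htF
    obtain ⟨p, q, htpq, hpq⟩ := exists_Ioo_avoiding F (by simpa using htF)
    refine ht.2 (ContinuousAt.continuousWithinAt ?_)
    refine (continuousAt_const (y := w t)).congr ?_
    filter_upwards [Ioo_mem_nhds htpq.1 htpq.2] with s hs
    exact h.const p q hpq t htpq s hs
  piecewise_monotone T _ :=
    ⟨F, fun p q _ _ hpq => Or.inl fun s hs t ht _ => (h.const p q hpq s hs t ht).le⟩

theorem intervalIntegrable (h : IsStepResponse L b F w x) {T : ℝ} (hT : 0 ≤ T) :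
    IntervalIntegrable (fun t => L (x t) + w t • b) volume 0 T := by
  refine ((L.continuous.comp h.continuous).intervalIntegrable 0 T).add ?_
  rw [intervalIntegrable_iff_integrableOn_Icc_of_le hT]
  exact Integrable.smul_const (h.integrableOn T) b

theorem eq_add_integral [CompleteSpace V] (h : IsStepResponse L b F w x) {T : ℝ} (hT : 0 ≤ T) :
    x T = x 0 + ∫ t in (0 : ℝ)..T, (L (x t) + w t • b) := by
  rw [integral_eq_of_hasDerivAt_off_countable_of_le x _ hT F.countable_toSet
    h.continuous.continuousOn (fun t ht => h.hasDerivAt t (by simpa using ht.2))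
    (h.intervalIntegrable hT)]
  abel

end IsStepResponse

variable (L : V →L[ℝ] V) (b : V)

/-- The free evolution of `ẋ = L x`. -/
noncomputable def freeFlow (t : ℝ) : V →L[ℝ] V := NormedSpace.exp (t • L)

theorem freeFlow_zero_apply (y : V) : freeFlow L 0 y = y := by
  simp [freeFlow]

/-- The response from rest of `ẋ = L x + w b` to the constant input `w = 1`. -/
noncomputable def unitStep (t : ℝ) : V := ∫ τ in (0 : ℝ)..t, freeFlow L τ b

theorem unitStep_zero : unitStep L b 0 = 0 := by simp [unitStep]

/-- The states spanned by the unit step response on `[0, 1]`. -/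
noncomputable def stepSpan : Submodule ℝ V := Submodule.span ℝ (unitStep L b '' Icc 0 1)

variable [CompleteSpace V]

theorem hasDerivAt_freeFlow_apply (y : V) (t : ℝ) :
    HasDerivAt (fun s => freeFlow L s y) (L (freeFlow L t y)) t := by
  have h := hasDerivAt_exp_smul_const' (𝕂 := ℝ) L t
  have h2 := h.clm_apply (hasDerivAt_const t y)
  simpa [freeFlow] using h2

theorem continuous_freeFlow_apply (y : V) : Continuous fun t => freeFlow L t y :=
  continuous_iff_continuousAt.2 fun t => (hasDerivAt_freeFlow_apply L y t).continuousAt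

theorem hasDerivAt_unitStep' (t : ℝ) : HasDerivAt (unitStep L b) (freeFlow L t b) t :=
  (continuous_freeFlow_apply L b).integral_hasStrictDerivAt 0 t |>.hasDerivAt

theorem continuous_unitStep : Continuous (unitStep L b) :=
  continuous_iff_continuousAt.2 fun t => (hasDerivAt_unitStep' L b t).continuousAt

theorem map_unitStep (t : ℝ) : L (unitStep L b t) + b = freeFlow L t b := by
  have h1 : ∫ τ in (0 : ℝ)..t, L (freeFlow L τ b) = freeFlow L t b - freeFlow L 0 b :=
    intervalIntegral.integral_eq_sub_of_hasDerivAt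
      (fun s _ => hasDerivAt_freeFlow_apply L b s)
      ((L.continuous.comp (continuous_freeFlow_apply L b)).intervalIntegrable _ _)
  rw [L.intervalIntegral_comp_comm ((continuous_freeFlow_apply L b).intervalIntegrable _ _),
    freeFlow_zero_apply] at h1
  rw [unitStep, h1, sub_add_cancel]

theorem hasDerivAt_unitStep (t : ℝ) :
    HasDerivAt (unitStep L b) (L (unitStep L b t) + b) t := by
  rw [map_unitStep]; exact hasDerivAt_unitStep' L b t

/-- Switching the unit step on at time `r`. -/
theorem isStepResponse_unitStep (r : ℝ) :
    IsStepResponse L b {r} (fun t => if r ≤ t then 1 else 0)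
      (fun t => unitStep L b (max (t - r) 0)) where
  continuous := (continuous_unitStep L b).comp (by fun_prop)
  hasDerivAt t ht := by
    rcases lt_or_gt_of_ne (show t ≠ r by simpa using ht) with htr | htr
    · have h0 : max (t - r) 0 = 0 := max_eq_right (by linarith)
      simp only [h0, unitStep_zero, not_le.2 htr, if_false, map_zero, zero_smul, add_zero]
      refine (hasDerivAt_const t (0 : V)).congr_of_eventuallyEq ?_
      filter_upwards [Iio_mem_nhds htr] with s hs
      have hs : s < r := hs
      rw [max_eq_right (by linarith), unitStep_zero]
    · have h0 : max (t - r) 0 = t - r := max_eq_left (by linarith)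
      simp only [h0, htr.le, if_true, one_smul]
      refine ((hasDerivAt_unitStep L b (t - r)).comp_sub_const t r).congr_of_eventuallyEq ?_
      filter_upwards [Ioi_mem_nhds htr] with s hs
      have hs : r < s := hs
      rw [max_eq_left (by linarith)]
  const p q hF s hs t ht := by
    have hr : ¬ (p < r ∧ r < q) := fun h => hF r h (by simp)
    have h1 := hs.1; have h2 := hs.2; have h3 := ht.1; have h4 := ht.2
    by_cases hrq : q ≤ r
    · rw [if_neg (by linarith), if_neg (by linarith)]
    · have : r ≤ p := by by_contra! h; exact hr ⟨h, not_le.1 hrq⟩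
      rw [if_pos (by linarith), if_pos (by linarith)]
  bounded := ⟨1, fun t => by split_ifs <;> simp⟩
  measurable := Measurable.ite measurableSet_Ici measurable_const measurable_const

/-- A step switched on at time 1 - t reaches `unitStep L b t` at time 1; linear combinations follow
by superposition. -/
theorem exists_isStepResponse_of_mem_stepSpan {y : V} (hy : y ∈ stepSpan L b) :
    ∃ F w x, IsStepResponse L b F w x ∧ x 0 = 0 ∧ x 1 = y := by
  induction hy using Submodule.span_induction with
  | mem y hy =>
    obtain ⟨t, ht, rfl⟩ := hy
    refine ⟨_, _, _, isStepResponse_unitStep L b (1 - t), ?_, ?_⟩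
    · rw [max_eq_right (by linarith [ht.2]), unitStep_zero]
    · rw [max_eq_left (by linarith [ht.1])]; congr 1; ring
  | zero =>
    exact ⟨_, _, _, IsStepResponse.of_free (x := fun _ => (0 : V)) (L := L) (b := b)
      (fun t => by simpa using hasDerivAt_const t (0 : V)), rfl, rfl⟩
  | add y z _ _ h1 h2 =>
    obtain ⟨F, w, x, h, h0, h1⟩ := h1
    obtain ⟨F', w', x', h', h0', h1'⟩ := h2
    exact ⟨_, _, _, h.add h', by simp [h0, h0'], by simp [h1, h1']⟩
  | smul r y _ h1 =>
    obtain ⟨F, w, x, h, h0, h1⟩ := h1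
    exact ⟨_, _, _, h.const_smul r, by simp [h0], by simp [h1]⟩

variable [FiniteDimensional ℝ V]

/-- The free flow of `b` is the derivative of the step response, and a finite-dimensional span is
closed, so it contains derivatives of curves lying in it. -/
theorem freeFlow_mem_stepSpan {t : ℝ} (ht : t ∈ Icc (0 : ℝ) 1) :
    freeFlow L t b ∈ stepSpan L b := by
  have h1 := range_derivWithin_subset_closure_span_image (unitStep L b) (s := Icc (0 : ℝ) 1)
    (t := Icc 0 1) (by rw [inter_self]; exact subset_closure)
  have h2 : derivWithin (unitStep L b) (Icc 0 1) t = freeFlow L t b :=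
    (hasDerivAt_unitStep' L b t).hasDerivWithinAt.derivWithin (uniqueDiffOn_Icc one_pos t ht)
  have h3 := h1 ⟨t, h2⟩
  rwa [(Submodule.closed_of_finiteDimensional
    (Submodule.span ℝ (unitStep L b '' Icc 0 1))).closure_eq] at h3

theorem input_mem_stepSpan : b ∈ stepSpan L b := by
  simpa [freeFlow_zero_apply] using freeFlow_mem_stepSpan L b (t := 0) (by simp)

/-- On generators, L(unitStep t) is the free flow of `b` at time t minus `b`, and both lie in the
span. -/
theorem map_mem_stepSpan {y : V} (hy : y ∈ stepSpan L b) : L y ∈ stepSpan L b := by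
  have h1 : stepSpan L b ≤ (stepSpan L b).comap (L : V →ₗ[ℝ] V) := by
    refine Submodule.span_le.2 ?_
    rintro _ ⟨t, ht, rfl⟩
    have h2 := sub_mem (freeFlow_mem_stepSpan L b ht) (input_mem_stepSpan L b)
    rw [← map_unitStep, add_sub_cancel_right] at h2
    exact h2
  exact h1 hy

end StepInputs

/-! ### Eigenvectors in invariant subspaces, and complexification of the network. -/

/-- An invariant subspace on which some left eigenvector does not vanish contains a right
eigenvector for the same eigenvalue. -/
theorem exists_eigenvector_mem_of_left_eigenvector {K E : Type*} [Field K] [AddCommGroup E]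
    [Module K E] [FiniteDimensional K E] (f : E →ₗ[K] E) (W : Submodule K E)
    (hW : ∀ x ∈ W, f x ∈ W) (μ : K) (ℓ : E →ₗ[K] K) (hℓ : ∀ x, ℓ (f x) = μ * ℓ x)
    {y : E} (hy : y ∈ W) (hℓy : ℓ y ≠ 0) : ∃ x ∈ W, x ≠ 0 ∧ f x = μ • x := by
  set h : W →ₗ[K] W := f.restrict hW - μ • LinearMap.id with hh
  -- The left eigenvector annihilates the range of f - μ but not y. In finite dimension f - μ
  -- restricted to `W` is then not injective either.
  have hns : ¬ Function.Surjective h := by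
    intro hs
    obtain ⟨x, hx⟩ := hs ⟨y, hy⟩
    apply hℓy
    have h1 : f x - μ • (x : E) = y := congrArg Subtype.val hx
    rw [← h1, map_sub, map_smul, hℓ, smul_eq_mul, sub_self]
  rw [← LinearMap.injective_iff_surjective, ← LinearMap.ker_eq_bot,
    LinearMap.ker_eq_bot'] at hns
  push Not at hns
  obtain ⟨x, hx, hx0⟩ := hns
  refine ⟨x, x.2, by simpa using hx0, ?_⟩
  have h1 : f x - μ • (x : E) = 0 := congrArg Subtype.val hx
  exact sub_eq_zero.1 h1

section NetworkMap

variable {n N : ℕ}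

/-- The linear vector field of a single-input single-output network over a commutative ring. -/
def networkMap {R : Type*} [CommRing R] (A : Matrix (Fin n) (Fin n) R) (b c : Fin n → R)
    (G : Fin N → Fin N → R) : (Fin N → Fin n → R) →ₗ[R] (Fin N → Fin n → R) where
  toFun x i := A *ᵥ x i + (∑ j, G i j * (c ⬝ᵥ x j - c ⬝ᵥ x i)) • b
  map_add' x y := by
    ext i k
    simp only [Pi.add_apply, Matrix.mulVec_add, dotProduct_add, Pi.smul_apply, smul_eq_mul]
    have : ∑ j, G i j * (c ⬝ᵥ x j + c ⬝ᵥ y j - (c ⬝ᵥ x i + c ⬝ᵥ y i)) =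
        ∑ j, G i j * (c ⬝ᵥ x j - c ⬝ᵥ x i) + ∑ j, G i j * (c ⬝ᵥ y j - c ⬝ᵥ y i) := by
      rw [← Finset.sum_add_distrib]; exact Finset.sum_congr rfl fun j _ => by ring
    rw [this]; ring
  map_smul' r x := by
    ext i k
    simp only [Pi.smul_apply, Pi.add_apply, Matrix.mulVec_smul, dotProduct_smul, smul_eq_mul,
      RingHom.id_apply]
    have : ∑ j, G i j * (r * (c ⬝ᵥ x j) - r * (c ⬝ᵥ x i)) =
        r * ∑ j, G i j * (c ⬝ᵥ x j - c ⬝ᵥ x i) := by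
      rw [Finset.mul_sum]; exact Finset.sum_congr rfl fun j _ => by ring
    rw [this]; ring

theorem networkMap_apply {R : Type*} [CommRing R] (A : Matrix (Fin n) (Fin n) R) (b c : Fin n → R)
    (G : Fin N → Fin N → R) (x : Fin N → Fin n → R) (i : Fin N) :
    networkMap A b c G x i = A *ᵥ x i + (∑ j, G i j * (c ⬝ᵥ x j - c ⬝ᵥ x i)) • b := rfl

/-- The coordinatewise real part. -/
def reVec (X : Fin N → Fin n → ℂ) : Fin N → Fin n → ℝ := fun i k => (X i k).re

/-- The coordinatewise inclusion of real into complex states. -/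
def complexVec (x : Fin N → Fin n → ℝ) : Fin N → Fin n → ℂ := fun i k => (x i k : ℂ)

theorem reVec_networkMap (A : Matrix (Fin n) (Fin n) ℝ) (b c : Fin n → ℝ) (G : Fin N → Fin N → ℝ)
    (X : Fin N → Fin n → ℂ) :
    reVec (networkMap (A.map (algebraMap ℝ ℂ)) (fun k => (b k : ℂ)) (fun k => (c k : ℂ))
      (fun i j => (G i j : ℂ)) X) = networkMap A b c G (reVec X) := by
  ext i k
  simp [reVec, networkMap_apply, Matrix.mulVec, dotProduct, Complex.re_sum, Complex.mul_re]

/-- The complexification of a real subspace of network states. -/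
def complexSpan (W : Submodule ℝ (Fin N → Fin n → ℝ)) : Submodule ℂ (Fin N → Fin n → ℂ) where
  carrier := {X | ∀ z : ℂ, reVec (z • X) ∈ W}
  add_mem' {X Y} hX hY z := by
    have : reVec (z • (X + Y)) = reVec (z • X) + reVec (z • Y) := by ext i k; simp [reVec, mul_add]
    rw [this]; exact W.add_mem (hX z) (hY z)
  zero_mem' z := by
    have : reVec (z • (0 : Fin N → Fin n → ℂ)) = 0 := by ext i k; simp [reVec]
    rw [this]; exact W.zero_mem
  smul_mem' r X hX z := by rw [smul_smul]; exact hX _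

theorem complexVec_mem_complexSpan {W : Submodule ℝ (Fin N → Fin n → ℝ)} {x : Fin N → Fin n → ℝ}
    (hx : x ∈ W) : complexVec x ∈ complexSpan W := by
  intro z
  have : reVec (z • complexVec x) = z.re • x := by ext i k; simp [reVec, complexVec]
  rw [this]; exact W.smul_mem _ hx

theorem norm_reVec_le (X : Fin N → Fin n → ℂ) : ‖reVec X‖ ≤ ‖X‖ :=
  (pi_norm_le_iff_of_nonneg (norm_nonneg _)).2 fun i =>
    (pi_norm_le_iff_of_nonneg (norm_nonneg _)).2 fun k =>
      (Complex.abs_re_le_norm _).trans ((norm_le_pi_norm (X i) k).trans (norm_le_pi_norm X i))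

theorem hasDerivAt_cexp_mul (μ : ℂ) (z : ℂ) (t : ℝ) :
    HasDerivAt (fun s : ℝ => z * Complex.exp (μ * s)) (μ * (z * Complex.exp (μ * t))) t := by
  have h1 : HasDerivAt (fun s : ℝ => μ * (s : ℂ)) μ t := by
    simpa using (Complex.ofRealCLM.hasDerivAt (x := t)).const_mul μ
  convert! (h1.cexp).const_mul z using 1
  ring

end NetworkMap

/-! ### Consequences of synchronization for unstable modes. -/

namespace Subsystem

variable {n N : ℕ} (S : Subsystem n 1) (α : ℝ) (g : Fin N → Fin N → ℝ)

/-- The vector field of the undisturbed network. -/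
noncomputable def stateMap : (Fin N → Fin n → ℝ) →L[ℝ] (Fin N → Fin n → ℝ) :=
  (networkMap S.A (fun k => S.B k 0) (S.C 0) (fun i j => α * g i j)).toContinuousLinearMap

/-- The complexified vector field of the undisturbed network. -/
noncomputable def complexStateMap : (Fin N → Fin n → ℂ) →ₗ[ℂ] (Fin N → Fin n → ℂ) :=
  networkMap (S.A.map (algebraMap ℝ ℂ)) (fun k => (S.B k 0 : ℂ)) (fun k => (S.C 0 k : ℂ))
    (fun i j => ((α * g i j : ℝ) : ℂ))

theorem stateMap_apply (x : Fin N → Fin n → ℝ) (i : Fin N) :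
    S.stateMap α g x i = S.A *ᵥ x i + S.coupling α g x i • fun k => S.B k 0 := by
  simp only [stateMap, LinearMap.coe_toContinuousLinearMap', networkMap_apply, coupling,
    Finset.mul_sum, mul_assoc]

theorem complexStateMap_apply (X : Fin N → Fin n → ℂ) (i : Fin N) :
    S.complexStateMap α g X i = S.A.map (algebraMap ℝ ℂ) *ᵥ X i +
      (∑ j, ((α * g i j : ℝ) : ℂ) * ((fun k => (S.C 0 k : ℂ)) ⬝ᵥ X j -
        (fun k => (S.C 0 k : ℂ)) ⬝ᵥ X i)) • fun k => (S.B k 0 : ℂ) := rfl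

theorem reVec_complexStateMap (X : Fin N → Fin n → ℂ) :
    reVec (S.complexStateMap α g X) = S.stateMap α g (reVec X) :=
  reVec_networkMap _ _ _ _ _

/-- The direction in which an input at vertex `s` acts. -/
def inputVec (s : Fin N) : Fin N → Fin n → ℝ := Pi.single s fun k => S.B k 0

theorem networkField_single (s : Fin N) (w : Fin 1 → ℝ) (x : Fin N → Fin n → ℝ) :
    S.networkField α g (Pi.single s w) x = S.stateMap α g x + w 0 • S.inputVec s := by
  funext i
  have h1 : (S.stateMap α g x + w 0 • S.inputVec s) i =
      S.stateMap α g x i + w 0 • S.inputVec s i := rfl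
  rw [networkField_apply, h1, stateMap_apply, add_assoc]
  by_cases h : i = s
  · subst h; simp [inputVec, add_smul]
  · simp [inputVec, h]

variable {S α g}

theorem isDisturbanceResponse_of_isStepResponse {s : Fin N} {F : Finset ℝ} {w : ℝ → ℝ}
    {x : ℝ → Fin N → Fin n → ℝ} (h : IsStepResponse (S.stateMap α g) (S.inputVec s) F w x)
    (h0 : x 0 = 0) : S.IsDisturbanceResponse α g s (fun t _ => w t) x := by
  refine ⟨⟨h.continuous.continuousOn, fun t ht => ?_⟩, h0⟩
  rw [h.eq_add_integral ht]
  simp only [networkField_single]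

theorem isTrajectory_of_hasDerivAt {x : ℝ → Fin N → Fin n → ℝ}
    (h : ∀ t, HasDerivAt x (S.stateMap α g (x t)) t) : S.IsTrajectory α g (fun _ => 0) x := by
  have h' : IsStepResponse (S.stateMap α g) 0 ∅ (fun _ => 0) x := IsStepResponse.of_free h
  refine ⟨h'.continuous.continuousOn, fun t ht => ?_⟩
  rw [h'.eq_add_integral ht]
  congr 1
  refine intervalIntegral.integral_congr fun τ _ => ?_
  ext i k
  simp [networkField_apply, stateMap_apply]

/-- The real trajectory through `Re X` of the network, for an eigenvector `X`. -/
theorem hasDerivAt_reVec_cexp {X : Fin N → Fin n → ℂ} {μ : ℂ}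
    (hX : S.complexStateMap α g X = μ • X) (z : ℂ) (t : ℝ) :
    HasDerivAt (fun s : ℝ => reVec ((z * Complex.exp (μ * s)) • X))
      (S.stateMap α g (reVec ((z * Complex.exp (μ * t)) • X))) t := by
  rw [← reVec_complexStateMap, map_smul, hX, hasDerivAt_pi]
  intro i
  rw [hasDerivAt_pi]
  intro k
  have h1 := ((hasDerivAt_cexp_mul μ z t).mul_const (X i k))
  have h2 := Complex.reCLM.hasFDerivAt.comp_hasDerivAt t h1
  convert! h2 using 1
  simp [reVec]
  ring_nf

theorem SyncManifoldAsymptoticallyStable.exists_tendsto_sub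
    (h : S.SyncManifoldAsymptoticallyStable α g) :
    ∃ δ : ℝ, 0 < δ ∧ ∀ x : ℝ → Fin N → Fin n → ℝ,
      (∀ t, HasDerivAt x (S.stateMap α g (x t)) t) → ‖x 0‖ < δ →
      ∀ i j k, Tendsto (fun t => x t i k - x t j k) atTop (𝓝 0) := by
  obtain ⟨δ, hδ, hx⟩ := h.2
  refine ⟨δ, hδ, fun x hd h0 i j k => ?_⟩
  have h1 := hx x (isTrajectory_of_hasDerivAt hd) (by
    refine (Metric.infDist_le_dist_of_mem (const_mem_syncManifold (N := N) 0)).trans_lt ?_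
    rw [show (fun _ => 0 : Fin N → Fin n → ℝ) = 0 from rfl, dist_zero_right]; exact h0)
  have h2 := h1.const_mul 2
  rw [mul_zero] at h2
  refine squeeze_zero_norm (fun t => ?_) h2
  -- `dist_le_of_infDist_lt` needs a strict bound; (2d + r)/4 lies strictly between the distance d
  -- and r/2.
  refine le_of_forall_gt fun r hr => ?_
  have h3 := dist_le_of_infDist_lt (show Metric.infDist (x t) (syncManifold N n) <
    (2 * Metric.infDist (x t) (syncManifold N n) + r) / 4 by linarith) i j k
  rw [Real.norm_eq_abs]
  linarith

/-- Along the mode, the difference of two components grows like exp(μt) unless it is zero. Real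
trajectories show only real parts, so two initial phases, r and r·i, are used to recover the
modulus. -/
theorem SyncManifoldAsymptoticallyStable.eigenvector_sync
    (h : S.SyncManifoldAsymptoticallyStable α g) {X : Fin N → Fin n → ℂ} {μ : ℂ} (hμ : 0 < μ.re)
    (hX : S.complexStateMap α g X = μ • X) (i j : Fin N) : X i = X j := by
  obtain ⟨δ, hδ, hconv⟩ := h.exists_tendsto_sub
  ext k
  set r : ℝ := δ / (‖X‖ + 1) with hr
  have hr0 : 0 < r := by positivity
  have hlim : ∀ z : ℂ, ‖z‖ = r →
      Tendsto (fun t : ℝ => (z * Complex.exp (μ * t) * (X i k - X j k)).re) atTop (𝓝 0) := by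
    intro z hz
    have h1 := hconv _ (hasDerivAt_reVec_cexp hX z) (by
      refine (norm_reVec_le _).trans_lt ?_
      simp only [Complex.ofReal_zero, mul_zero, Complex.exp_zero, mul_one]
      rw [norm_smul, hz, hr, div_mul_eq_mul_div, div_lt_iff₀ (by positivity)]
      nlinarith [norm_nonneg X]) i j k
    refine h1.congr fun t => ?_
    simp only [reVec, Pi.smul_apply, smul_eq_mul, mul_sub, Complex.sub_re]
  have h1 := (hlim r (by simp [abs_of_pos hr0])).norm
  have h2 := (hlim (r * Complex.I) (by simp [abs_of_pos hr0])).norm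
  have h3 := h1.add h2
  simp only [norm_zero, add_zero] at h3
  have h4 : r * ‖X i k - X j k‖ ≤ 0 := by
    refine ge_of_tendsto h3 ((eventually_ge_atTop 0).mono fun t ht => ?_)
    set q := (r : ℂ) * Complex.exp (μ * t) * (X i k - X j k) with hq
    have h5 : (r : ℂ) * Complex.I * Complex.exp (μ * t) * (X i k - X j k) = Complex.I * q := by
      rw [hq]; ring
    rw [h5]
    have h6 : ‖(Complex.I * q).re‖ = |q.im| := by simp
    rw [h6, Real.norm_eq_abs]
    refine le_trans ?_ (Complex.norm_le_abs_re_add_abs_im q)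
    rw [hq, norm_mul, norm_mul, Complex.norm_real, Real.norm_of_nonneg hr0.le, Complex.norm_exp]
    have h7 : 1 ≤ Real.exp ((μ * t).re) := by
      refine Real.one_le_exp ?_
      simp; positivity
    refine mul_le_mul_of_nonneg_right ?_ (norm_nonneg _)
    nlinarith
  have h5 : ‖X i k - X j k‖ = 0 := le_antisymm (by nlinarith) (norm_nonneg _)
  exact sub_eq_zero.1 (norm_eq_zero.1 h5)

/-- If u·B = 0, the coupling cannot influence u·(x i - x j), which then evolves as exp(μt) and
cannot tend to zero from a nonzero start. -/
theorem SyncManifoldAsymptoticallyStable.left_eigenvector_input_ne_zero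
    (h : S.SyncManifoldAsymptoticallyStable α g) {i j : Fin N} (hij : i ≠ j) {u : Fin n → ℂ}
    {μ : ℂ} (hμ : 0 < μ.re) (hu : u ᵥ* S.A.map (algebraMap ℝ ℂ) = μ • u) (hu0 : u ≠ 0) :
    u ⬝ᵥ (fun k => (S.B k 0 : ℂ)) ≠ 0 := by
  intro hub
  obtain ⟨δ, hδ, hconv⟩ := h.exists_tendsto_sub
  obtain ⟨k₀, hk₀⟩ := Function.ne_iff.1 hu0
  set x₀ : Fin N → Fin n → ℝ := Pi.single i (Pi.single k₀ (δ / 2)) with hx₀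
  have hn : ‖x₀‖ < δ := by
    rw [hx₀, Pi.norm_single, Pi.norm_single, Real.norm_of_nonneg (by positivity)]; linarith
  set x := fun t => freeFlow (S.stateMap α g) t x₀ with hx
  have hd : ∀ t, HasDerivAt x (S.stateMap α g (x t)) t := hasDerivAt_freeFlow_apply _ _
  have hx0 : x 0 = x₀ := freeFlow_zero_apply _ _
  set f : ℝ → ℂ := fun t => ∑ k, u k * ((x t i k - x t j k : ℝ) : ℂ) with hf
  have hcol : ∀ y : Fin n → ℝ, ∑ k, u k * (((S.A *ᵥ y) k : ℝ) : ℂ) = μ * ∑ k, u k * (y k : ℂ) := by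
    intro y
    have h1 : (fun k => (((S.A *ᵥ y) k : ℝ) : ℂ)) =
        S.A.map (algebraMap ℝ ℂ) *ᵥ fun k => (y k : ℂ) := by
      ext k; simp [Matrix.mulVec, dotProduct]
    have h2 : u ⬝ᵥ (fun k => (((S.A *ᵥ y) k : ℝ) : ℂ)) = μ * (u ⬝ᵥ fun k => (y k : ℂ)) := by
      rw [h1, Matrix.dotProduct_mulVec, hu, smul_dotProduct, smul_eq_mul]
    exact h2
  have hfd : ∀ t, HasDerivAt f (μ * f t) t := by
    intro t
    have hdk : ∀ k, HasDerivAt (fun s => u k * ((x s i k - x s j k : ℝ) : ℂ))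
        (u k * ((S.stateMap α g (x t) i k - S.stateMap α g (x t) j k : ℝ) : ℂ)) t := by
      intro k
      have h1 := (hasDerivAt_pi.1 (hasDerivAt_pi.1 (hd t) i) k).sub
        (hasDerivAt_pi.1 (hasDerivAt_pi.1 (hd t) j) k)
      exact (h1.ofReal_comp).const_mul (u k)
    have h2 := HasDerivAt.fun_sum (u := Finset.univ) fun k _ => hdk k
    convert! h2 using 1
    have h3 := hcol (fun k => x t i k - x t j k)
    rw [hf]
    dsimp only
    rw [← h3]
    have h4 : (S.A *ᵥ fun k => x t i k - x t j k) = S.A *ᵥ x t i - S.A *ᵥ x t j :=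
      Matrix.mulVec_sub _ _ _
    have h5 : ∀ k, u k * ((S.stateMap α g (x t) i k - S.stateMap α g (x t) j k : ℝ) : ℂ) =
        u k * (((S.A *ᵥ fun k => x t i k - x t j k) k : ℝ) : ℂ) +
        ((S.coupling α g (x t) i - S.coupling α g (x t) j : ℝ) : ℂ) * (u k * (S.B k 0 : ℂ)) := by
      intro k
      rw [h4, stateMap_apply, stateMap_apply]
      simp only [Pi.add_apply, Pi.sub_apply, Pi.smul_apply, smul_eq_mul]
      push_cast
      ring
    rw [Finset.sum_congr rfl fun k _ => h5 k, Finset.sum_add_distrib, ← Finset.mul_sum]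
    have h6 : ∑ k, u k * (S.B k 0 : ℂ) = 0 := hub
    rw [h6, mul_zero, add_zero]
  have hfe : ∀ t : ℝ, Complex.exp (-μ * t) * f t = f 0 := by
    have hc : ∀ t, HasDerivAt (fun s : ℝ => 1 * Complex.exp (-μ * s) * f s) 0 t := by
      intro t
      convert! (hasDerivAt_cexp_mul (-μ) 1 t).mul (hfd t) using 1
      ring
    have := is_const_of_deriv_eq_zero (fun t => (hc t).differentiableAt) fun t => (hc t).deriv
    intro t
    simpa using this t 0
  have hf0 : f 0 ≠ 0 := by
    rw [hf]
    dsimp only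
    rw [hx0, Finset.sum_eq_single k₀]
    · simpa [hx₀, hij.symm, hδ.ne'] using hk₀
    · intro k _ hk; simp [hx₀, hk, hij.symm]
    · simp
  have hft : Tendsto f atTop (𝓝 0) := by
    have : Tendsto f atTop (𝓝 (∑ k, u k * ((0 : ℝ) : ℂ))) :=
      tendsto_finsetSum _ fun k _ => ((Complex.continuous_ofReal.tendsto 0).comp
        (hconv x hd (by rw [hx0]; exact hn) i j k)).const_mul (u k)
    simpa using this
  have h1 : ‖f 0‖ ≤ 0 := by
    have h2 := hft.norm
    rw [norm_zero] at h2
    refine ge_of_tendsto h2 ((eventually_ge_atTop 0).mono fun t ht => ?_)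
    rw [← hfe t, norm_mul, Complex.norm_exp]
    have : Real.exp ((-μ * t).re) ≤ 1 := by
      refine Real.exp_le_one_iff.2 ?_
      simp; positivity
    nlinarith [norm_nonneg (f t)]
  exact hf0 (norm_le_zero_iff.1 h1)

end Subsystem

/-! ### Exponential moments and real periods of a mode. -/

section Exponentials

/-- Two distinct signals are told apart by a finite-horizon exponential moment. -/
theorem exists_exponential_moment_ne_zero {q : ℝ → ℝ} (hq : Continuous q) (μ : ℂ) {t : ℝ}
    (ht : 0 < t) (hqt : q t ≠ 0) :
    ∃ η : ℝ, 0 < η ∧ ∫ τ in (0 : ℝ)..η, Complex.exp (μ * τ) * q τ ≠ 0 := by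
  -- If the moment vanished for all η > 0, its derivative exp(μt) q(t) at t would vanish too.
  by_contra! hcon
  have hc : Continuous fun τ : ℝ => Complex.exp (μ * τ) * q τ := by fun_prop
  have h1 := (hc.integral_hasStrictDerivAt 0 t).hasDerivAt
  have h2 : HasDerivAt (fun η => ∫ τ in (0 : ℝ)..η, Complex.exp (μ * τ) * q τ) 0 t := by
    refine (hasDerivAt_const t (0 : ℂ)).congr_of_eventuallyEq ?_
    filter_upwards [Ioi_mem_nhds ht] with η hη
    exact hcon η hη
  have h3 := h1.unique h2
  simp [Complex.exp_ne_zero, hqt] at h3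

/-- After a full turn of the phase the mode is multiplied by a real factor, so waiting amplifies it
without rotating it. -/
theorem exists_real_period (μ : ℂ) (hμ : 0 < μ.re) :
    ∃ p ρ : ℝ, 0 < p ∧ 1 < ρ ∧ Complex.exp (μ * p) = ρ := by
  obtain ⟨p, hp, m, hm⟩ : ∃ p : ℝ, 0 < p ∧ ∃ m : ℤ, μ.im * p = m * (2 * Real.pi) := by
    by_cases h : μ.im = 0
    · exact ⟨1, one_pos, 0, by simp [h]⟩
    · rcases lt_or_gt_of_ne h with h | h
      · refine ⟨-(2 * Real.pi) / μ.im, div_pos_of_neg_of_neg (by linarith [Real.pi_pos]) h, -1, ?_⟩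
        have := h.ne
        field_simp; simp
      · refine ⟨2 * Real.pi / μ.im, by positivity, 1, ?_⟩
        have := h.ne'
        field_simp; simp
  refine ⟨p, Real.exp (μ.re * p), hp, Real.one_lt_exp_iff.2 (by positivity), ?_⟩
  have h1 : μ * p = ((μ.re * p : ℝ) : ℂ) + m * (2 * Real.pi * Complex.I) := by
    apply Complex.ext
    · simp
    · simpa using hm
  rw [h1, Complex.exp_add, Complex.exp_int_mul_two_pi_mul_I, mul_one, Complex.ofReal_exp]

end Exponentials

/-! ### Left null vectors and left eigenvectors. -/

section Laplacian

variable {n N : ℕ}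

/-- A weighted digraph Laplacian has a nonzero left null vector. -/
theorem exists_laplacian_left_null [Nonempty (Fin N)] (G : Fin N → Fin N → ℂ) :
    ∃ p : Fin N → ℂ, p ≠ 0 ∧ ∀ z : Fin N → ℂ, ∑ i, p i * ∑ j, G i j * (z j - z i) = 0 := by
  set M : Matrix (Fin N) (Fin N) ℂ := Matrix.of G - Matrix.diagonal fun i => ∑ j, G i j with hM
  have hmul : ∀ z : Fin N → ℂ, M *ᵥ z = fun i => ∑ j, G i j * (z j - z i) := by
    intro z
    ext i
    rw [hM, Matrix.sub_mulVec, Pi.sub_apply, Matrix.mulVec_diagonal, Finset.sum_mul]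
    simp [Matrix.mulVec, dotProduct, mul_sub]
  have hdet : M.det = 0 :=
    Matrix.exists_mulVec_eq_zero_iff.1 ⟨fun _ => 1, Function.ne_iff.2
      ⟨Classical.arbitrary _, one_ne_zero⟩, by rw [hmul]; ext i; simp⟩
  obtain ⟨p, hp, hpM⟩ := Matrix.exists_vecMul_eq_zero_iff.2 hdet
  refine ⟨p, hp, fun z => ?_⟩
  have h : p ⬝ᵥ (M *ᵥ z) = 0 := by rw [Matrix.dotProduct_mulVec, hpM, zero_dotProduct]
  rw [hmul] at h
  exact h

theorem exists_left_eigenvector {A : Matrix (Fin n) (Fin n) ℂ} {μ : ℂ}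
    (h : Module.End.HasEigenvalue (Matrix.toLin' A) μ) :
    ∃ u : Fin n → ℂ, u ≠ 0 ∧ u ᵥ* A = μ • u := by
  obtain ⟨v, hv, hv0⟩ := h.exists_hasEigenvector
  rw [Module.End.mem_eigenspace_iff, Matrix.toLin'_apply] at hv
  have hdet : (A - μ • 1).det = 0 :=
    Matrix.exists_mulVec_eq_zero_iff.1 ⟨v, hv0, by
      rw [Matrix.sub_mulVec, hv, Matrix.smul_mulVec, Matrix.one_mulVec, sub_self]⟩
  obtain ⟨u, hu0, hu⟩ := Matrix.exists_vecMul_eq_zero_iff.2 hdet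
  refine ⟨u, hu0, ?_⟩
  rwa [Matrix.vecMul_sub, Matrix.vecMul_smul, Matrix.vecMul_one, sub_eq_zero] at hu

end Laplacian

/-! ### A reachable, observable unstable mode. -/

namespace Subsystem

variable {n N : ℕ} {S : Subsystem n 1} {α : ℝ} {g : Fin N → Fin N → ℝ}

/-- The complexified output row. -/
def complexOutput (S : Subsystem n 1) : Fin n → ℂ := fun k => (S.C 0 k : ℂ)

theorem re_complexOutput (S : Subsystem n 1) (X : Fin N → Fin n → ℂ) (i : Fin N) :
    (S.complexOutput ⬝ᵥ X i).re = S.C 0 ⬝ᵥ reVec X i := by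
  simp [complexOutput, dotProduct, reVec]

/-- If the synchronization manifold is asymptotically stable, then an unstable mode of the network
can be excited from some vertex. -/
theorem SyncManifoldAsymptoticallyStable.exists_reachable_eigenvector
    (h : S.SyncManifoldAsymptoticallyStable α g) (hN : 2 ≤ N) {μ : ℂ} (hμ : S.IsPole μ)
    (hre : 0 < μ.re) :
    ∃ s : Fin N, ∃ X ∈ complexSpan (stepSpan (S.stateMap α g) (S.inputVec s)),
      X ≠ 0 ∧ S.complexStateMap α g X = μ • X := by
  have : Nonempty (Fin N) := ⟨⟨0, by omega⟩⟩
  obtain ⟨u, hu0, hu⟩ := exists_left_eigenvector hμ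
  have hub := h.left_eigenvector_input_ne_zero (i := ⟨0, by omega⟩) (j := ⟨1, by omega⟩)
    (by simp) hre hu hu0
  obtain ⟨p, hp0, hp⟩ := exists_laplacian_left_null (fun i j => ((α * g i j : ℝ) : ℂ))
  obtain ⟨s, hs⟩ := Function.ne_iff.1 hp0
  -- This is p ⊗ u. Summation against p cancels the coupling and leaves only the action of `A` on u,
  -- so ℓ is a left eigenvector of the network; on the input at s it equals p_s (u·B), which is
  -- nonzero.
  let ℓ : (Fin N → Fin n → ℂ) →ₗ[ℂ] ℂ :=
    { toFun := fun X => ∑ i, p i * (u ⬝ᵥ X i)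
      map_add' := fun X Y => by simp [dotProduct_add, mul_add, Finset.sum_add_distrib]
      map_smul' := fun r X => by
        simp only [Pi.smul_apply, dotProduct_smul, smul_eq_mul, RingHom.id_apply, Finset.mul_sum]
        exact Finset.sum_congr rfl fun i _ => by ring }
  have hℓ : ∀ X, ℓ X = ∑ i, p i * (u ⬝ᵥ X i) := fun X => rfl
  refine ⟨s, ?_⟩
  refine exists_eigenvector_mem_of_left_eigenvector (S.complexStateMap α g) _ ?_ μ ℓ ?_
    (complexVec_mem_complexSpan (input_mem_stepSpan (S.stateMap α g) (S.inputVec s))) ?_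
  · intro X hX z
    rw [← map_smul, reVec_complexStateMap]
    exact map_mem_stepSpan _ _ (hX z)
  · intro X
    have h1 : ∀ i, p i * (u ⬝ᵥ S.complexStateMap α g X i) = μ * (p i * (u ⬝ᵥ X i)) +
        (u ⬝ᵥ fun k => (S.B k 0 : ℂ)) * (p i * ∑ j, ((α * g i j : ℝ) : ℂ) *
          (S.complexOutput ⬝ᵥ X j - S.complexOutput ⬝ᵥ X i)) := by
      intro i
      rw [complexStateMap_apply, dotProduct_add, Matrix.dotProduct_mulVec, hu, smul_dotProduct,
        dotProduct_smul, smul_eq_mul, smul_eq_mul]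
      unfold complexOutput
      ring
    rw [hℓ, hℓ, Finset.sum_congr rfl fun i _ => h1 i, Finset.sum_add_distrib, ← Finset.mul_sum,
      ← Finset.mul_sum, hp fun i => S.complexOutput ⬝ᵥ X i, mul_zero, add_zero]
  · rw [hℓ, Finset.sum_eq_single s]
    · refine mul_ne_zero hs ?_
      have : complexVec (S.inputVec s) s = fun k => (S.B k 0 : ℂ) := by
        ext k; simp [complexVec, inputVec]
      rwa [this]
    · intro i _ hi
      have : complexVec (S.inputVec s) i = 0 := by ext k; simp [complexVec, inputVec, hi]
      rw [this, dotProduct_zero, mul_zero]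
    · simp

/-- A synchronous mode is an eigenvector of `A` at each vertex. If its output vanished, the mode
supported on one vertex alone would also be an eigenvector of the network, and it is not
synchronous. -/
theorem SyncManifoldAsymptoticallyStable.output_ne_zero
    (h : S.SyncManifoldAsymptoticallyStable α g) (hN : 2 ≤ N) {μ : ℂ} (hre : 0 < μ.re)
    {X : Fin N → Fin n → ℂ} (hX0 : X ≠ 0) (hX : S.complexStateMap α g X = μ • X) (i : Fin N) :
    S.complexOutput ⬝ᵥ X i ≠ 0 := by
  intro hc
  have hsync := h.eigenvector_sync hre hX
  have hAX : S.A.map (algebraMap ℝ ℂ) *ᵥ X i = μ • X i := by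
    have h1 := congrFun hX i
    rw [complexStateMap_apply] at h1
    simpa [hsync _ i] using h1
  have hY : S.complexStateMap α g (Pi.single i (X i)) = μ • Pi.single i (X i) := by
    have h0 : ∀ j, S.complexOutput ⬝ᵥ (Pi.single i (X i) : Fin N → Fin n → ℂ) j = 0 := by
      intro j
      by_cases hj : j = i
      · subst hj; simpa using hc
      · simp [hj]
    unfold complexOutput at h0
    funext j
    rw [complexStateMap_apply]
    simp only [h0, sub_self, mul_zero, Finset.sum_const_zero, zero_smul, add_zero]
    by_cases hj : j = i
    · subst hj; simpa using hAX
    · simp [hj]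
  have : Nontrivial (Fin N) := Fin.nontrivial_iff_two_le.2 hN
  obtain ⟨j, hj⟩ := exists_ne i
  have h1 := h.eigenvector_sync hre hY i j
  simp only [Pi.single_eq_same, Pi.single_eq_of_ne hj] at h1
  exact hX0 (funext fun k => by rw [hsync k i, h1]; rfl)

/-- If an observable mode is reachable from `s`, then the unit step response at `s` differs from
that at some other vertex. -/
theorem exists_output_unitStep_ne (hN : 2 ≤ N) {s : Fin N} {X : Fin N → Fin n → ℂ}
    (hX : X ∈ complexSpan (stepSpan (S.stateMap α g) (S.inputVec s)))
    (hc : S.complexOutput ⬝ᵥ X s ≠ 0) :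
    ∃ b, b ≠ s ∧ ∃ t : ℝ, 0 < t ∧ S.C 0 ⬝ᵥ unitStep (S.stateMap α g) (S.inputVec s) t b ≠
      S.C 0 ⬝ᵥ unitStep (S.stateMap α g) (S.inputVec s) t s := by
  by_contra! hcon
  set φ := unitStep (S.stateMap α g) (S.inputVec s) with hφ
  have heq : ∀ t, 0 ≤ t → ∀ i, S.C 0 ⬝ᵥ φ t i = S.C 0 ⬝ᵥ φ t s := by
    intro t ht i
    rcases eq_or_ne i s with rfl | hi
    · rfl
    rcases ht.eq_or_lt with rfl | ht
    · simp [hφ, unitStep_zero]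
    · exact hcon i hi t ht
  have hcoup : ∀ t, 0 ≤ t → ∀ i, S.coupling α g (φ t) i = 0 := by
    intro t ht i
    simp [coupling, heq t ht]
  have : Nontrivial (Fin N) := Fin.nontrivial_iff_two_le.2 hN
  obtain ⟨b, hb⟩ := exists_ne s
  let A' : (Fin n → ℝ) →L[ℝ] (Fin n → ℝ) := (Matrix.toLin' S.A).toContinuousLinearMap
  -- With equal outputs the coupling is zero, so a vertex b other than s obeys the free equation
  -- from rest and stays there.
  have hzero : ∀ t ∈ Icc (0 : ℝ) 1, φ t b = 0 := by
    refine eq_zero_of_abs_deriv_le_mul_abs_self_of_eq_zero_right (f := fun t => φ t b)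
      (f' := fun t => A' (φ t b)) (K := ‖A'‖) ?_ ?_ ?_ ?_
    · exact ((continuous_apply b).comp (continuous_unitStep _ _)).continuousOn
    · intro t ht
      have h1 := hasDerivAt_pi.1 (hasDerivAt_unitStep (S.stateMap α g) (S.inputVec s) t) b
      have h2 : (S.stateMap α g (φ t) + S.inputVec s) b = A' (φ t b) := by
        rw [Pi.add_apply, stateMap_apply, hcoup t ht.1, zero_smul, add_zero]
        simp [inputVec, hb, A']
      rw [← h2]
      exact h1.hasDerivWithinAt
    · simp [hφ, unitStep_zero]
    · exact fun t _ => A'.le_opNorm _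
  -- The output at s equals that at b, hence is zero on all generators of the reachable space; this
  -- contradicts the observability of X.
  have hout : ∀ y ∈ stepSpan (S.stateMap α g) (S.inputVec s), S.C 0 ⬝ᵥ y s = 0 := by
    intro y hy
    induction hy using Submodule.span_induction with
    | mem y hy =>
      obtain ⟨t, ht, rfl⟩ := hy
      rw [← heq t ht.1 b, hzero t ht, dotProduct_zero]
    | zero => simp
    | add y z _ _ h1 h2 => rw [Pi.add_apply, dotProduct_add, h1, h2, add_zero]
    | smul r y _ h1 => rw [Pi.smul_apply, dotProduct_smul, h1, smul_zero]
  apply hc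
  have h1 : ∀ z : ℂ, (z * (S.complexOutput ⬝ᵥ X s)).re = 0 := by
    intro z
    have := re_complexOutput S (z • X) s
    rw [hout _ (hX z), Pi.smul_apply, dotProduct_smul, smul_eq_mul] at this
    exact this
  apply Complex.ext
  · simpa using h1 1
  · simpa using h1 (-Complex.I)

end Subsystem

theorem isSeparatingCutset_singleton {N : ℕ} (g : Fin N → Fin N → ℝ) (s : Fin N) :
    IsSeparatingCutset g s {s} ∅ (Finset.univ \ {s}) where
  nonempty := Finset.singleton_nonempty s
  union_eq := Finset.empty_union _
  disjoint := Finset.disjoint_empty_left _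
  no_edge a ha := by simp at ha
  source_mem := by simp

/-! ### Part (i): the destabilizing disturbance. -/

namespace Subsystem

variable {n N : ℕ} {S : Subsystem n 1} {α : ℝ} {g : Fin N → Fin N → ℝ}

/-- A network excited in a synchronous unstable mode `X` during `[0, 1]`, to which a unit step at
vertex `s` is applied after `k` further periods of the mode: there is a disturbance response whose
energies at time `T` are the energy of the excitation phase, a common term, and the
contribution of the superposition of the amplified mode and of the unit step response. -/
theorem exists_response_energy_eq {s : Fin N} {X : Fin N → Fin n → ℂ} {μ : ℂ}
    (hX : X ∈ complexSpan (stepSpan (S.stateMap α g) (S.inputVec s)))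
    (hXμ : S.complexStateMap α g X = μ • X) (hsync : ∀ i, X i = X s)
    {p ρ : ℝ} (hp : 0 < p) (hρ : Complex.exp (μ * p) = ρ) {η : ℝ} (hη : 0 < η) :
    ∃ D : Fin N → ℝ, ∀ k : ℕ, ∃ (w : ℝ → Fin 1 → ℝ) (x : ℝ → Fin N → Fin n → ℝ) (T m : ℝ), 0 < T ∧
      (∀ l, SatisfiesDirichlet fun t => w t l) ∧ S.IsDisturbanceResponse α g s w x ∧
      ∀ i, S.energy x T i = D i + m + ∫ τ in (0 : ℝ)..η,
        (ρ ^ k * (Complex.exp (μ * τ) * (S.complexOutput ⬝ᵥ X s)).re +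
          S.C 0 ⬝ᵥ unitStep (S.stateMap α g) (S.inputVec s) τ i) ^ 2 := by
  set L := S.stateMap α g with hL
  set β := S.inputVec s with hβ
  have hX1 : reVec X ∈ stepSpan L β := by simpa using hX 1
  obtain ⟨F, w₁, x₁, h₁, hx0, hx1⟩ := exists_isStepResponse_of_mem_stepSpan L β hX1
  refine ⟨fun i => ∫ t in (0 : ℝ)..1, (S.C 0 ⬝ᵥ x₁ t i) ^ 2, fun k => ?_⟩
  set T₀ : ℝ := 1 + k * p with hT₀
  have hT₀1 : 1 ≤ T₀ := by
    have : 0 ≤ (k : ℝ) * p := by positivity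
    linarith
  -- The factor exp(-μ) makes the free mode pass through Re X at time 1, where the excitation ends.
  set y : ℝ → Fin N → Fin n → ℝ :=
    fun t => reVec ((Complex.exp (-μ) * Complex.exp (μ * t)) • X) with hy
  have hfree : IsStepResponse L β ∅ (fun _ => 0) y :=
    IsStepResponse.of_free (hasDerivAt_reVec_cexp hXμ (Complex.exp (-μ)))
  have h₂ := hfree.add (isStepResponse_unitStep L β T₀)
  have hy1 : y 1 = reVec X := by
    rw [hy]
    dsimp only
    rw [← Complex.exp_add]
    simp
  have h := h₁.glue h₂ (r := 1) (by
    rw [hx1, hy1, max_eq_right (by linarith), unitStep_zero, add_zero])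
  set x : ℝ → Fin N → Fin n → ℝ :=
    fun t => if t ≤ 1 then x₁ t else y t + unitStep L β (max (t - T₀) 0) with hx
  have hcx : ∀ i, Continuous fun t => (S.C 0 ⬝ᵥ x t i) ^ 2 := by
    intro i
    have : Continuous fun z : Fin N → Fin n → ℝ => (S.C 0 ⬝ᵥ z i) ^ 2 := by fun_prop
    exact this.comp h.continuous
  set Y : ℝ → ℝ :=
    fun t => (Complex.exp (-μ) * Complex.exp (μ * t) * (S.complexOutput ⬝ᵥ X s)).re with hY
  have hout : ∀ t i, S.C 0 ⬝ᵥ y t i = Y t := by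
    intro t i
    rw [hy, ← re_complexOutput, Pi.smul_apply, dotProduct_smul, hsync i, smul_eq_mul]
  have hYper : ∀ τ : ℝ, Y (τ + T₀) =
      ρ ^ k * (Complex.exp (μ * τ) * (S.complexOutput ⬝ᵥ X s)).re := by
    intro τ
    have h1 : Complex.exp (-μ) * Complex.exp (μ * ((τ + T₀ : ℝ) : ℂ)) =
        ((ρ ^ k : ℝ) : ℂ) * Complex.exp (μ * τ) := by
      rw [Complex.ofReal_pow, ← hρ, ← Complex.exp_nat_mul, ← Complex.exp_add, ← Complex.exp_add]
      congr 1
      rw [hT₀]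
      push_cast
      ring
    rw [hY]
    dsimp only
    rw [h1, mul_assoc, Complex.re_ofReal_mul]
  refine ⟨_, x, T₀ + η, ∫ t in (1 : ℝ)..T₀, Y t ^ 2, by linarith, fun _ => h.satisfiesDirichlet,
    isDisturbanceResponse_of_isStepResponse h (by simp [hx, hx0]), fun i => ?_⟩
  rw [energy_eq, ← intervalIntegral.integral_add_adjacent_intervals
    ((hcx i).intervalIntegrable 0 T₀) ((hcx i).intervalIntegrable T₀ (T₀ + η)),
    ← intervalIntegral.integral_add_adjacent_intervals
    ((hcx i).intervalIntegrable 0 1) ((hcx i).intervalIntegrable 1 T₀)]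
  congr 1
  · congr 1
    · refine intervalIntegral.integral_congr fun t ht => ?_
      rw [uIcc_of_le zero_le_one] at ht
      simp [hx, ht.2]
    · refine intervalIntegral.integral_congr_ae (Eventually.of_forall fun t ht => ?_)
      rw [uIoc_of_le hT₀1] at ht
      rw [hx]
      simp only [not_le.2 ht.1, if_false, max_eq_right (sub_nonpos.2 ht.2), unitStep_zero, add_zero,
        hout]
  · have h3 := intervalIntegral.integral_comp_add_right (a := 0) (b := η)
      (fun t => (S.C 0 ⬝ᵥ x t i) ^ 2) T₀
    rw [zero_add, add_comm η] at h3
    rw [← h3]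
    refine intervalIntegral.integral_congr_ae (Eventually.of_forall fun τ hτ => ?_)
    rw [uIoc_of_le hη.le] at hτ
    have h4 : ¬ τ + T₀ ≤ 1 := by linarith [hτ.1]
    rw [hx]
    simp only [h4, if_false, add_sub_cancel_right, max_eq_left hτ.1.le, Pi.add_apply,
      dotProduct_add, hout, hYper]

theorem HasOpenRHPPole.not_propagationStable (hS : S.HasOpenRHPPole) (hN : 2 ≤ N) :
    ¬ PropagationStable S α g := by
  rintro ⟨hsync, henergy⟩
  obtain ⟨μ, hμ, hre⟩ := hS
  obtain ⟨s, X, hXW, hX0, hXμ⟩ := hsync.exists_reachable_eigenvector hN hμ hre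
  have hc := hsync.output_ne_zero hN hre hX0 hXμ s
  obtain ⟨b, hbs, t, ht, hbt⟩ := exists_output_unitStep_ne hN hXW hc
  set φ := unitStep (S.stateMap α g) (S.inputVec s) with hφ
  set P : Fin N → ℝ → ℝ := fun i τ => S.C 0 ⬝ᵥ φ τ i with hP
  have hPc : ∀ i, Continuous (P i) := by
    intro i
    have : Continuous fun z : Fin N → Fin n → ℝ => S.C 0 ⬝ᵥ z i := by fun_prop
    exact this.comp (continuous_unitStep _ _)
  obtain ⟨η, hη, hQ⟩ := exists_exponential_moment_ne_zero
    (q := fun τ => P b τ - P s τ) ((hPc b).sub (hPc s)) μ ht (sub_ne_zero.2 hbt)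
  set Q := ∫ τ in (0 : ℝ)..η, Complex.exp (μ * τ) * ((P b τ - P s τ : ℝ) : ℂ) with hQdef
  obtain ⟨p, ρ, hp, hρ1, hρ⟩ := exists_real_period μ hre
  set ζ := S.complexOutput ⬝ᵥ X s with hζ
  -- This phase turns the cross term ∫ Z (P b - P s) into |ζQ|², which is positive.
  set a : ℂ := (starRingEnd ℂ) (ζ * Q) with ha
  obtain ⟨D, hD⟩ := exists_response_energy_eq (X := a • X) (μ := μ)
    (Submodule.smul_mem _ a hXW) (by rw [map_smul, hXμ, smul_comm])
    (fun i => by rw [Pi.smul_apply, Pi.smul_apply, hsync.eigenvector_sync hre hXμ i s]) hp hρ hη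
  have hout : S.complexOutput ⬝ᵥ (a • X) s = a * ζ := by
    rw [Pi.smul_apply, dotProduct_smul, smul_eq_mul]
  rw [hout] at hD
  set Z : ℝ → ℝ := fun τ => (Complex.exp (μ * τ) * (a * ζ)).re with hZ
  have hZc : Continuous Z := by rw [hZ]; fun_prop
  have hgain : 0 < ∫ τ in (0 : ℝ)..η, Z τ * (P b τ - P s τ) := by
    have h1 : ∫ τ in (0 : ℝ)..η, Z τ * (P b τ - P s τ) = (a * ζ * Q).re := by
      have hcont : Continuous fun τ : ℝ => a * ζ * (Complex.exp (μ * τ) *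
          ((P b τ - P s τ : ℝ) : ℂ)) := by
        have := hPc b
        have := hPc s
        fun_prop
      have h2 := Complex.reCLM.intervalIntegral_comp_comm (hcont.intervalIntegrable (μ := volume) 0 η)
      rw [intervalIntegral.integral_const_mul] at h2
      simp only [Complex.reCLM_apply] at h2
      rw [← h2]
      refine intervalIntegral.integral_congr fun τ _ => ?_
      rw [← Complex.re_mul_ofReal]
      congr 1
      ring
    rw [h1, mul_assoc, ha, ← Complex.normSq_eq_conj_mul_self, Complex.ofReal_re]
    exact Complex.normSq_pos.2 (mul_ne_zero hc hQ)
  have hZP : ∀ i, IntervalIntegrable (fun τ => Z τ * P i τ) volume 0 η := fun i =>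
    (hZc.mul (hPc i)).intervalIntegrable 0 η
  have hexpand : ∀ (r : ℝ) (i : Fin N), ∫ τ in (0 : ℝ)..η, (r * Z τ + P i τ) ^ 2 =
      r ^ 2 * (∫ τ in (0 : ℝ)..η, Z τ ^ 2) + 2 * r * (∫ τ in (0 : ℝ)..η, Z τ * P i τ) +
        ∫ τ in (0 : ℝ)..η, P i τ ^ 2 := by
    intro r i
    have i1 : IntervalIntegrable (fun τ => r ^ 2 * Z τ ^ 2) volume 0 η :=
      (continuous_const.mul (hZc.pow 2)).intervalIntegrable 0 η
    have i2 := (hZP i).const_mul (2 * r)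
    have i3 : IntervalIntegrable (fun τ => P i τ ^ 2) volume 0 η :=
      ((hPc i).pow 2).intervalIntegrable 0 η
    rw [← intervalIntegral.integral_const_mul, ← intervalIntegral.integral_const_mul,
      ← intervalIntegral.integral_add i1 i2, ← intervalIntegral.integral_add (i1.add i2) i3]
    refine intervalIntegral.integral_congr fun τ _ => ?_
    ring
  have hsub : ∫ τ in (0 : ℝ)..η, Z τ * (P b τ - P s τ) =
      (∫ τ in (0 : ℝ)..η, Z τ * P b τ) - ∫ τ in (0 : ℝ)..η, Z τ * P s τ := by
    rw [← intervalIntegral.integral_sub (hZP b) (hZP s)]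
    simp only [mul_sub]
  set I := ∫ τ in (0 : ℝ)..η, Z τ * (P b τ - P s τ) with hI
  -- In E_b ≤ E_s, the common term m and the squared mode ρ^(2k) ∫ Z² cancel. What remains bounds
  -- ρ^k · 2I, with I > 0 and ρ > 1, by a constant independent of k.
  have hbound : ∀ k : ℕ, ρ ^ k * (2 * I) ≤ D s - D b + (∫ τ in (0 : ℝ)..η, P s τ ^ 2) -
      ∫ τ in (0 : ℝ)..η, P b τ ^ 2 := by
    intro k
    obtain ⟨w, x, T, m, hT, hw, hx, hE⟩ := hD k
    have h1 := henergy s w hw x hx {s} ∅ (Finset.univ \ {s}) (isSeparatingCutset_singleton g s)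
      T hT b (by simp [hbs])
    rw [Finset.sup'_singleton, hE, hE] at h1
    have h2 := hexpand (ρ ^ k) b
    have h3 := hexpand (ρ ^ k) s
    rw [hsub]
    simp only [hZ, hP] at h1 h2 h3 ⊢
    linarith
  obtain ⟨k, hk⟩ := (((tendsto_pow_atTop_atTop_of_one_lt hρ1).atTop_mul_const
    (show 0 < 2 * I by linarith)).eventually_gt_atTop (D s - D b +
      (∫ τ in (0 : ℝ)..η, P s τ ^ 2) - ∫ τ in (0 : ℝ)..η, P b τ ^ 2)).exists
  exact absurd (hbound k) (not_le.2 hk)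

end Subsystem

theorem corollary1 {n : ℕ} (S : Subsystem n 1) :
    (S.HasOpenRHPPole →
      ∀ N : ℕ, 2 ≤ N → ∀ g : Fin N → Fin N → ℝ, (∀ i j, i ≠ j → 0 ≤ g i j) →
        ∀ α : ℝ, ¬ PropagationStable S α g) ∧
    (S.StrictlyStable →
      ∀ (N : ℕ) (g : Fin N → Fin N → ℝ), (∀ i j, i ≠ j → 0 ≤ g i j) →
        ∃ αbar : ℝ, 0 < αbar ∧
          ∀ α : ℝ, 0 ≤ α → α ≤ αbar → PropagationStable S α g) :=
  ⟨fun h _ hN _ _ _ => h.not_propagationStable hN, fun h _ g hg => h.exists_propagationStable g hg⟩
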